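/- Let $S=\mathbb{C}\langle \xi_0,\xi_1\rangle$ be the shuffle algebra over $\mathbb{C}$ on the letters $\xi_0=\frac{dz}{z}$, $\xi_1=\frac{dz}{1-z}$, with shuffle product $⧢$ and unit the empty word $\mathbf 1$. Let $\tau:S\to S$ be the linear map that reverses each word and exchanges $\xi_0$ and $\xi_1$. Put $S^0=\mathbb{C}\mathbf 1+S\xi_1$ and $S^{10}=\mathbb{C}\mathbf 1+\xi_0S\xi_1$. Every $u\in S$ can be written uniquely as a finite sum $u=\sum_j w_j\,⧢\,\xi_0^j$ with $w_j\in S^0$, and uniquely as a finite sum $u=\sum_{i,j}\xi_1^i\,⧢\, w_{ij}\,⧢\,\xi_0^j$ with $w_{ij}\in S^{10}$; set $\mathrm{reg}^0(u)=w_0$ and $\mathrm{reg}^{10}(u)=w_{00}$. Let $D_0=\mathbb{C}\setminus[1,\infty)$ and $D_1=\mathbb{C}\setminus(-\infty,0]$, and let $\log$ be the principal logarithm. For $z\in D_0$ and a word $w=\xi_{i_1}\cdots\xi_{i_r}\in S^0$ let $\mathrm{Li}(w;z)=\int_0^z\xi_{i_1}\cdots\xi_{i_r}$ be the iterated integral,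 defined by $\mathrm{Li}(\mathbf 1;z)=1$ and $\mathrm{Li}(\xi_i v;z)=\int_0^z\xi_i\,\mathrm{Li}(v;\cdot)$, and extend linearly to $S^0$. For $w=\sum_j w_j\,⧢\,\xi_0^j\in S$ with $w_j\in S^0$ and $z\in D_0\cap D_1$ put $\mathrm{Li}(w;z)=\sum_j\mathrm{Li}(w_j;z)\frac{\log^j z}{j!}$. Let $\zeta:S^{10}\to\mathbb{C}$ be the linear map with $\zeta(\mathbf 1)=1$ and $$\zeta(\xi_0^{k_1-1}\xi_1\cdots\xi_0^{k_r-1}\xi_1)=\sum_{n_1>\cdots>n_r>0}\frac{1}{n_1^{k_1}\cdots n_r^{k_r}}\qquad(k_1\ge 2).$$ **Theorem.** Assume the duality relations $\zeta(\mathrm{reg}^{10}(w))=\zeta(\mathrm{reg}^{10}(\tau(w)))$ for all words $w$. Then there is exactly one pair of families $f^{(0)}(\bullet;z),f^{(1)}(\bullet;z):S\to\mathbb{C}$, $z\in D_0\cap D_1$, of (unital, $\mathbb{C}$-linear) shuffle homomorphisms with $$f^{(0)}(\xi_0;z)=\log z,\qquad f^{(1)}(\xi_0;z)=\log(1-z)\qquad(z\in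 D_0\cap D_1)$$ that satisfies the following three conditions. 1. For every word $w$, the functions $f^{(0)}(\mathrm{reg}^0(w);z)$ and $f^{(1)}(\mathrm{reg}^0(w);z)$ are holomorphic on $D_0$ and on $D_1$ respectively (that is, they extend holomorphically from $D_0\cap D_1$ to $D_0$, respectively $D_1$; the extensions are denoted by the same symbols), and $$\sum_{uv=w}f^{(1)}(\tau(u);z)\,f^{(0)}(v;z)=\zeta(\mathrm{reg}^{10}(w))\qquad(z\in D_0\cap D_1),$$ where the sum runs over all factorizations of $w$ as a concatenation of two (possibly empty) words. 2. For every word $w$ and $i=0,1$, $\ \frac{d}{dz}f^{(i)}(\mathrm{reg}^0(w);z)\to 0$ as $z\to\infty$, $z\in D_i$. 3. For every non-empty word $w$, $\ f^{(0)}(\mathrm{reg}^0(w);0)=0$. This solution is given by $$f^{(0)}(w;z)=\mathrm{Li}(w;z),\qquad f^{(1)}(w;z)=\mathrm{Li}(w;1-z)\qquad(w\in S,\ z\in D_0\cap D_1),$$ and the holomorphic extensions of $f^{(0)}(\mathrm{reg}^0(w);z)$ and $f^{(1)}(\mathrm{reg}^0(w);z)$ to $D_0$ and $D_1$ are $\mathrm{Li}(\mathrm{reg}^0(w);z)$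 and $\mathrm{Li}(\mathrm{reg}^0(w);1-z)$. -/

import Mathlib

namespace MPL

/-- Words in the two letters `ξ₀ = dz / z` (letter `0`) and `ξ₁ = dz / (1 - z)` (letter `1`).
The empty word is `[]`, and concatenation of words is `++`. -/
abbrev Word : Type := List (Fin 2)

/-- The underlying complex vector space of the shuffle algebra `S = ℂ⟨ξ₀, ξ₁⟩`: finite complex
linear combinations of words. The shuffle product is `shuffle` below (the pointwise product of
finitely supported functions is never used). -/
abbrev ShuffleAlg : Type := Word →₀ ℂ

/-- A word regarded as an element of `S`. -/
noncomputable def word (w : Word) : ShuffleAlg := Finsupp.single w 1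

/-- Left concatenation `u ↦ ξ_a u`, as a linear map of `S`. -/
noncomputable def consMap (a : Fin 2) : ShuffleAlg →ₗ[ℂ] ShuffleAlg :=
  Finsupp.lmapDomain ℂ ℂ (List.cons a)

/-- The shuffle product of two words. -/
noncomputable def shuffleWord : Word → Word → ShuffleAlg
  | [], v => word v
  | a :: u, [] => word (a :: u)
  | a :: u, b :: v =>
      consMap a (shuffleWord u (b :: v)) + consMap b (shuffleWord (a :: u) v)
termination_by u v => u.length + v.length

/-- The shuffle product on `S`, the bilinear extension of `shuffleWord`. -/
noncomputable def shuffle (x y : ShuffleAlg) : ShuffleAlg :=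
  x.sum fun u a => y.sum fun v b => (a * b) • shuffleWord u v

/-- A linear form on `S` is a shuffle homomorphism `S → ℂ` if it is unital and multiplicative for
the shuffle product. -/
structure IsShuffleHom (φ : ShuffleAlg →ₗ[ℂ] ℂ) : Prop where
  map_one : φ (word []) = 1
  map_shuffle : ∀ x y : ShuffleAlg, φ (shuffle x y) = φ x * φ y

/-- The linear map `τ : S → S` which reverses a word and exchanges the letters `ξ₀` and `ξ₁`. -/
noncomputable def tau : ShuffleAlg →ₗ[ℂ] ShuffleAlg :=
  Finsupp.lmapDomain ℂ ℂ fun w : Word => (w.map Fin.rev).reverse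

/-- The subspace `S⁰ = ℂ 1 + S ξ₁`. -/
noncomputable def S0 : Submodule ℂ ShuffleAlg :=
  Finsupp.supported ℂ ℂ {w : Word | w = [] ∨ ∃ v : Word, w = v ++ [1]}

/-- The subspace `S¹⁰ = ℂ 1 + ξ₀ S ξ₁`. -/
noncomputable def S10 : Submodule ℂ ShuffleAlg :=
  Finsupp.supported ℂ ℂ {w : Word | w = [] ∨ ∃ v : Word, w = 0 :: (v ++ [1])}

/-- `u = ∑ⱼ cⱼ ⧢ ξ₀ʲ` with all `cⱼ` in `S⁰`, where `ξ₀ʲ` is the word `ξ₀ ⋯ ξ₀` of length `j`. -/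
def IsPoly0 (u : ShuffleAlg) (c : ℕ →₀ ShuffleAlg) : Prop :=
  (∀ j, c j ∈ S0) ∧
    u = c.sum fun j v => shuffle v (word (List.replicate j 0))

/-- `u = ∑ᵢⱼ ξ₁ⁱ ⧢ cᵢⱼ ⧢ ξ₀ʲ` with all `cᵢⱼ` in `S¹⁰`. -/
def IsPoly10 (u : ShuffleAlg) (c : ℕ × ℕ →₀ ShuffleAlg) : Prop :=
  (∀ p, c p ∈ S10) ∧
    u = c.sum fun p v =>
      shuffle (shuffle (word (List.replicate p.1 1)) v) (word (List.replicate p.2 0))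

open Classical in
/-- The coefficients of `u` in the polynomial representation `S = S⁰[ξ₀]`. Such a representation
exists and is unique for every `u`, so that the default value never occurs. -/
noncomputable def coeff0 (u : ShuffleAlg) : ℕ →₀ ShuffleAlg :=
  if h : ∃ c, IsPoly0 u c then h.choose else 0

open Classical in
/-- The coefficients of `u` in the polynomial representation `S = S¹⁰[ξ₀, ξ₁]`. Such a
representation exists and is unique for every `u`, so that the default value never occurs. -/
noncomputable def coeff10 (u : ShuffleAlg) : ℕ × ℕ →₀ ShuffleAlg :=
  if h : ∃ c, IsPoly10 u c then h.choose else 0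

/-- The regularization `reg⁰ : S → S⁰`: the constant term in `S = S⁰[ξ₀]`. -/
noncomputable def reg0 (u : ShuffleAlg) : ShuffleAlg := coeff0 u 0

/-- The regularization `reg¹⁰ : S → S¹⁰`: the constant term in `S = S¹⁰[ξ₀, ξ₁]`. -/
noncomputable def reg10 (u : ShuffleAlg) : ShuffleAlg := coeff10 u (0, 0)

/-- The domain `D₀ = ℂ ∖ [1, ∞)`. -/
def D0 : Set ℂ := {z | ¬ (z.im = 0 ∧ 1 ≤ z.re)}

/-- The domain `D₁ = ℂ ∖ (-∞, 0]`. -/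
def D1 : Set ℂ := {z | ¬ (z.im = 0 ∧ z.re ≤ 0)}

/-- The coefficient functions of the forms `ξ₀ = dz / z` and `ξ₁ = dz / (1 - z)`. -/
noncomputable def formCoeff (a : Fin 2) (z : ℂ) : ℂ :=
  if a = 0 then 1 / z else 1 / (1 - z)

/-- The iterated integral `∫₀ᶻ ξ_{i₁} ⋯ ξ_{iᵣ}`, along the straight segment from `0` to `z`
(`D₀` is star-shaped about `0`). It is meant for words in `S⁰` and `z ∈ D₀`. -/
noncomputable def iterInt : Word → ℂ → ℂ
  | [], _ => 1
  | a :: w, z => ∫ t in (0 : ℝ)..1, z * (formCoeff a (t * z) * iterInt w (t * z))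

/-- The extended multiple polylogarithm
`Li(w; z) = ∑ⱼ Li(wⱼ; z) (log z)ʲ / j!` for `w = ∑ⱼ wⱼ ⧢ ξ₀ʲ` with `wⱼ ∈ S⁰`, where on `S⁰` the
multiple polylogarithm is the linear extension of the iterated integral. For `w ∈ S⁰` this is the
multiple polylogarithm itself, meaningful on `D₀`; in general it is meaningful on `D₀ ∩ D₁`. -/
noncomputable def Li (w : ShuffleAlg) (z : ℂ) : ℂ :=
  (coeff0 w).sum fun j c =>
    (c.sum fun v a => a * iterInt v z) * (Complex.log z ^ j / (j.factorial : ℂ))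

/-- The truncated sum `∑_{N > n₁ > ⋯ > nᵣ > 0} 1 / (n₁^k₁ ⋯ nᵣ^kᵣ)`. -/
noncomputable def truncSum : List ℕ → ℕ → ℂ
  | [], _ => 1
  | k :: ks, N => ∑ n ∈ Finset.Ioo 0 N, 1 / (n : ℂ) ^ k * truncSum ks n

/-- The multiple zeta value `ζ(k₁, …, kᵣ) = ∑_{n₁ > ⋯ > nᵣ > 0} 1 / (n₁^k₁ ⋯ nᵣ^kᵣ)` (for `k₁ ≥ 2`,
where the series converges absolutely; the value for the empty index is `1`). The outer summation
variable is `n₁ = n + 1`. -/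
noncomputable def mzv : List ℕ → ℂ
  | [] => 1
  | k :: ks => ∑' n : ℕ, 1 / ((n + 1 : ℕ) : ℂ) ^ k * truncSum ks (n + 1)

/-- `indexAux k w` is the index of the word `ξ₀^(k-1) w`. -/
def indexAux : ℕ → Word → List ℕ
  | _, [] => []
  | k, a :: w => if a = 0 then indexAux (k + 1) w else k :: indexAux 1 w

/-- The index `[k₁, …, kᵣ]` of a word `ξ₀^(k₁-1) ξ₁ ⋯ ξ₀^(kᵣ-1) ξ₁`. -/
def index (w : Word) : List ℕ := indexAux 1 w

/-- The linear map `ζ` on `S¹⁰` with `ζ(ξ₀^(k₁-1) ξ₁ ⋯ ξ₀^(kᵣ-1) ξ₁) = ζ(k₁, …, kᵣ)`. -/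
noncomputable def zeta (u : ShuffleAlg) : ℂ := u.sum fun w a => a * mzv (index w)

/-- `g` is the holomorphic extension to `U` of the function `f` on `D₀ ∩ D₁`. -/
def IsHolExt (U : Set ℂ) (f : ↥(D0 ∩ D1) → ℂ) (g : ℂ → ℂ) : Prop :=
  DifferentiableOn ℂ g U ∧ ∀ z : ↥(D0 ∩ D1), g z = f z

/-- The additive Riemann–Hilbert problem for a pair `f⁽⁰⁾(•; z), f⁽¹⁾(•; z)`, `z ∈ D₀ ∩ D₁`, of
shuffle homomorphisms `S → ℂ`. That `f⁽ⁱ⁾(reg⁰ w; z)` is holomorphic on `Dᵢ` means that this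
function on `D₀ ∩ D₁` has a (necessarily unique) holomorphic extension to `Dᵢ`, and the asymptotic
and normalizing conditions concern that extension. -/
structure IsRHSolution (f0 f1 : ↥(D0 ∩ D1) → (ShuffleAlg →ₗ[ℂ] ℂ)) : Prop where
  hom0 : ∀ z, IsShuffleHom (f0 z)
  hom1 : ∀ z, IsShuffleHom (f1 z)
  log0 : ∀ z, f0 z (word [0]) = Complex.log z
  log1 : ∀ z, f1 z (word [0]) = Complex.log (1 - z)
  hol0 : ∀ w : Word, ∃ g, IsHolExt D0 (fun z => f0 z (reg0 (word w))) g
  hol1 : ∀ w : Word, ∃ g, IsHolExt D1 (fun z => f1 z (reg0 (word w))) g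
  /-- The sum over all factorizations `w = u v` into two words. -/
  functional_equation : ∀ (w : Word) (z : ↥(D0 ∩ D1)),
    ∑ k ∈ Finset.range (w.length + 1), f1 z (tau (word (w.take k))) * f0 z (word (w.drop k))
      = zeta (reg10 (word w))
  asymptotic0 : ∀ (w : Word) (g : ℂ → ℂ), IsHolExt D0 (fun z => f0 z (reg0 (word w))) g →
    Filter.Tendsto (deriv g) (Bornology.cobounded ℂ ⊓ Filter.principal D0) (nhds 0)
  asymptotic1 : ∀ (w : Word) (g : ℂ → ℂ), IsHolExt D1 (fun z => f1 z (reg0 (word w))) g →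
    Filter.Tendsto (deriv g) (Bornology.cobounded ℂ ⊓ Filter.principal D1) (nhds 0)
  normalizing : ∀ w : Word, w ≠ [] → ∀ g : ℂ → ℂ,
    IsHolExt D0 (fun z => f0 z (reg0 (word w))) g → g 0 = 0

end MPL

open MPL

namespace MPL

/-! ### The shuffle product as a bilinear map -/

/-! Existence. On `S0` the iterated integrals are holomorphic on `D0`. They respect shuffles because
both sides have the same derivative and vanish at 0; adding the powers of log z extends them to a
shuffle homomorphism `liMap z` on all of S. The convolution `liConv z` of Li(τ(·); 1 - z) with Li(·;
z) has derivative zero, since the product rule telescopes, so it does not depend on z in `D0 ∩ D1`.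
It is again a shuffle homomorphism and it kills both letters, so it factors through `reg10`
(`IsShuffleHom.map_reg10`). On a word ξ₀vξ₁ its constant value is its limit at 1 from the left:
every factorization with a non-empty left factor tends to 0, and the remaining term tends to the
multiple zeta value by Abel's theorem. This gives `liConv_eq_zeta`. The asymptotic conditions follow
from the bound O(|z|^(1/2)) for iterated integrals, as both forms are O(1/|z|).

Uniqueness (`IsRHSolution.eq_on_word`). Induct on word length. For two solutions (f0, f1) and (g0,
g1), the inner terms of the functional equation agree, so f0(w) - g0(w) = g1(τw) - f1(τw). By
homogeneity of S = S⁰[ξ₀], these differences do not change when w and τw are replaced by their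
`reg0`. One side is then holomorphic on `D0`, the other on `D1`, and together they form an entire
function whose derivative tends to 0 at infinity. By Liouville the derivative vanishes, and the
normalization at 0 makes the function zero.

The algebra rests on one observation: stripping a letter from either end of a word is a derivation
for the shuffle product, and `S0`, `S10` are kernels of such derivations. -/

theorem word_induction {p : ShuffleAlg → Prop} (x : ShuffleAlg) (zero : p 0)
    (add : ∀ x y, p x → p y → p (x + y)) (smul : ∀ (a : ℂ) x, p x → p (a • x))
    (basis : ∀ w, p (word w)) : p x := by
  induction x using Finsupp.induction_linear with
  | zero => exact zero
  | add f g hf hg => exact add f g hf hg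
  | single w a =>
    have h := smul a _ (basis w)
    rwa [word, Finsupp.smul_single, smul_eq_mul, mul_one] at h

theorem linearMap_ext_word {M : Type*} [AddCommMonoid M] [Module ℂ M] {f g : ShuffleAlg →ₗ[ℂ] M}
    (h : ∀ w, f (word w) = g (word w)) : f = g :=
  Finsupp.lhom_ext' fun w => LinearMap.ext_ring (h w)

@[simp] theorem consMap_word (a : Fin 2) (w : Word) : consMap a (word w) = word (a :: w) := by
  simp [consMap, word]

@[simp] theorem tau_word (w : Word) : tau (word w) = word (w.map Fin.rev).reverse := by
  simp [tau, word]

/-- The shuffle product as a bilinear map. -/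
noncomputable def shuffleBilin : ShuffleAlg →ₗ[ℂ] ShuffleAlg →ₗ[ℂ] ShuffleAlg :=
  Finsupp.linearCombination ℂ fun u => Finsupp.linearCombination ℂ (shuffleWord u)

theorem shuffle_eq (x y : ShuffleAlg) : shuffle x y = shuffleBilin x y := by
  simp only [shuffle, shuffleBilin, Finsupp.linearCombination_apply]
  rw [Finsupp.sum, Finsupp.sum, LinearMap.sum_apply]
  refine Finset.sum_congr rfl fun u _ => ?_
  rw [LinearMap.smul_apply, Finsupp.linearCombination_apply, Finsupp.smul_sum]
  simp only [mul_smul]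

theorem shuffle_word (u v : Word) : shuffle (word u) (word v) = shuffleWord u v := by
  simp [shuffle_eq, shuffleBilin, word]

theorem shuffle_add_left (x y z : ShuffleAlg) :
    shuffle (x + y) z = shuffle x z + shuffle y z := by simp [shuffle_eq]

theorem shuffle_add_right (x y z : ShuffleAlg) :
    shuffle x (y + z) = shuffle x y + shuffle x z := by simp [shuffle_eq]

theorem shuffle_smul_left (a : ℂ) (x y : ShuffleAlg) :
    shuffle (a • x) y = a • shuffle x y := by simp [shuffle_eq]

theorem shuffle_smul_right (a : ℂ) (x y : ShuffleAlg) :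
    shuffle x (a • y) = a • shuffle x y := by simp [shuffle_eq]

@[simp] theorem shuffle_zero_left (x : ShuffleAlg) : shuffle 0 x = 0 := by simp [shuffle_eq]

@[simp] theorem shuffle_zero_right (x : ShuffleAlg) : shuffle x 0 = 0 := by simp [shuffle_eq]

@[simp] theorem shuffleWord_nil_left (v : Word) : shuffleWord [] v = word v := by
  rw [shuffleWord]

@[simp] theorem shuffleWord_nil_right (u : Word) : shuffleWord u [] = word u := by
  cases u <;> rw [shuffleWord]

theorem shuffleWord_cons_cons (a b : Fin 2) (u v : Word) :
    shuffleWord (a :: u) (b :: v) =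
      consMap a (shuffleWord u (b :: v)) + consMap b (shuffleWord (a :: u) v) := by
  rw [shuffleWord]

@[simp] theorem shuffle_one_left (x : ShuffleAlg) : shuffle (word []) x = x := by
  induction x using word_induction with
  | zero => simp
  | add x y hx hy => rw [shuffle_add_right, hx, hy]
  | smul a x hx => rw [shuffle_smul_right, hx]
  | basis w => simp [shuffle_word]

@[simp] theorem shuffle_one_right (x : ShuffleAlg) : shuffle x (word []) = x := by
  induction x using word_induction with
  | zero => simp
  | add x y hx hy => rw [shuffle_add_left, hx, hy]
  | smul a x hx => rw [shuffle_smul_left, hx]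
  | basis w => simp [shuffle_word]

/-- Induction for statements about pairs of words, on the sum of the lengths. -/
theorem word_pair_induction {p : Word → Word → Prop} (nil_left : ∀ v, p [] v)
    (nil_right : ∀ u, p u [])
    (cons_cons : ∀ a u b v, p u (b :: v) → p (a :: u) v → p (a :: u) (b :: v)) (u v : Word) :
    p u v := by
  induction u generalizing v with
  | nil => exact nil_left v
  | cons a u ihu =>
    induction v with
    | nil => exact nil_right _
    | cons b v ihv => exact cons_cons a u b v (ihu _) ihv

theorem shuffleWord_comm (u v : Word) : shuffleWord u v = shuffleWord v u := by
  induction u, v using word_pair_induction with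
  | nil_left v => simp
  | nil_right u => simp
  | cons_cons a u b v h1 h2 =>
    rw [shuffleWord_cons_cons, shuffleWord_cons_cons b a, h1, h2, add_comm]

theorem shuffle_comm (x y : ShuffleAlg) : shuffle x y = shuffle y x := by
  induction x using word_induction with
  | zero => simp
  | add x y hx hy => rw [shuffle_add_right, shuffle_add_left, hx, hy]
  | smul a x hx => rw [shuffle_smul_right, shuffle_smul_left, hx]
  | basis u =>
    induction y using word_induction with
    | zero => simp
    | add x y hx hy => rw [shuffle_add_right, shuffle_add_left, hx, hy]
    | smul a x hx => rw [shuffle_smul_right, shuffle_smul_left, hx]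
    | basis v => rw [shuffle_word, shuffle_word, shuffleWord_comm]

theorem shuffle_consMap_consMap (a b : Fin 2) (x y : ShuffleAlg) :
    shuffle (consMap a x) (consMap b y) =
      consMap a (shuffle x (consMap b y)) + consMap b (shuffle (consMap a x) y) := by
  induction x using word_induction with
  | zero => simp
  | add x y hx hy => simp only [map_add, shuffle_add_left, hx, hy]; abel
  | smul a x hx => simp only [map_smul, shuffle_smul_left, hx, smul_add]
  | basis u =>
    induction y using word_induction with
    | zero => simp
    | add x y hx hy => simp only [map_add, shuffle_add_right, hx, hy]; abel
    | smul a x hx => simp only [map_smul, shuffle_smul_right, hx, smul_add]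
    | basis v => simp only [consMap_word, shuffle_word, shuffleWord_cons_cons]

theorem shuffle_word_assoc (u v w : Word) :
    shuffle (shuffle (word u) (word v)) (word w) =
      shuffle (word u) (shuffle (word v) (word w)) := by
  induction u generalizing v w with
  | nil => simp
  | cons a u ihu =>
    induction v generalizing w with
    | nil => simp
    | cons b v ihv =>
      induction w with
      | nil => simp
      | cons c w ihw =>
        have e1 : shuffle (word (a :: u)) (word (b :: v)) =
            consMap a (shuffle (word u) (word (b :: v))) +
              consMap b (shuffle (word (a :: u)) (word v)) := by
          simp only [shuffle_word, shuffleWord_cons_cons]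
        have e2 : shuffle (word (b :: v)) (word (c :: w)) =
            consMap b (shuffle (word v) (word (c :: w))) +
              consMap c (shuffle (word (b :: v)) (word w)) := by
          simp only [shuffle_word, shuffleWord_cons_cons]
        have hu := ihu (b :: v) (c :: w)
        have hv := ihv (c :: w)
        rw [e1, e2, shuffle_add_left, shuffle_add_right, ← consMap_word c w, ← consMap_word a u,
          shuffle_consMap_consMap, shuffle_consMap_consMap, shuffle_consMap_consMap,
          shuffle_consMap_consMap]
        simp only [consMap_word] at *
        rw [hu, hv, e2]
        rw [e1, shuffle_add_left] at ihw
        -- Three terms begin with a, b or c. The first two match by `hu` and `hv`; the c-term of the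
        -- left side arrives in two pieces, which must be joined before `ihw` applies.
        have : consMap c (shuffle (consMap a (shuffle (word u) (word (b :: v)))) (word w)) +
            consMap c (shuffle (consMap b (shuffle (word (a :: u)) (word v))) (word w)) =
            consMap c (shuffle (word (a :: u)) (shuffle (word (b :: v)) (word w))) := by
          rw [← map_add, ihw]
        rw [← this, shuffle_add_right, map_add]
        abel

theorem shuffle_assoc (x y z : ShuffleAlg) :
    shuffle (shuffle x y) z = shuffle x (shuffle y z) := by
  induction x using word_induction with
  | zero => simp
  | add x y hx hy => simp only [shuffle_add_left, hx, hy]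
  | smul a x hx => simp only [shuffle_smul_left, hx]
  | basis u =>
    induction y using word_induction with
    | zero => simp
    | add x y hx hy => simp only [shuffle_add_left, shuffle_add_right, hx, hy]
    | smul a x hx => simp only [shuffle_smul_left, shuffle_smul_right, hx]
    | basis v =>
      induction z using word_induction with
      | zero => simp
      | add x y hx hy => simp only [shuffle_add_right, hx, hy]
      | smul a x hx => simp only [shuffle_smul_right, hx]
      | basis w => exact shuffle_word_assoc u v w

/-! ### The anti-automorphism `τ` -/

/-- Right concatenation `u ↦ u ξ_a`, as a linear map of `S`. -/
noncomputable def snocMap (a : Fin 2) : ShuffleAlg →ₗ[ℂ] ShuffleAlg :=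
  Finsupp.lmapDomain ℂ ℂ fun w => w ++ [a]

@[simp] theorem snocMap_word (a : Fin 2) (w : Word) : snocMap a (word w) = word (w ++ [a]) := by
  simp [snocMap, word]

theorem snocMap_consMap (a b : Fin 2) (x : ShuffleAlg) :
    snocMap a (consMap b x) = consMap b (snocMap a x) := by
  have h : snocMap a ∘ₗ consMap b = consMap b ∘ₗ snocMap a := linearMap_ext_word (by simp)
  exact LinearMap.congr_fun h x

theorem tau_consMap (a : Fin 2) (x : ShuffleAlg) : tau (consMap a x) = snocMap a.rev (tau x) := by
  have h : tau ∘ₗ consMap a = snocMap a.rev ∘ₗ tau := linearMap_ext_word (by simp)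
  exact LinearMap.congr_fun h x

@[simp] theorem tau_tau (x : ShuffleAlg) : tau (tau x) = x := by
  have h : tau ∘ₗ tau = LinearMap.id := linearMap_ext_word (by simp [Function.comp_def])
  exact LinearMap.congr_fun h x

theorem shuffleWord_singleton_snoc (a b : Fin 2) (v : Word) :
    shuffleWord [a] (v ++ [b]) =
      snocMap a (word (v ++ [b])) + snocMap b (shuffleWord [a] v) := by
  induction v with
  | nil => simp [shuffleWord_cons_cons, add_comm]
  | cons c v ih =>
    rw [List.cons_append, shuffleWord_cons_cons, ih, shuffleWord_cons_cons]
    simp only [map_add, snocMap_consMap, shuffleWord_nil_left, snocMap_word, consMap_word,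
      List.cons_append]
    abel

/-- The shuffle is defined by recursion on first letters. The same recursion on last letters is what
makes the reversal `tau` multiplicative. -/
theorem shuffleWord_snoc_snoc (a b : Fin 2) (u v : Word) :
    shuffleWord (u ++ [a]) (v ++ [b]) =
      snocMap a (shuffleWord u (v ++ [b])) + snocMap b (shuffleWord (u ++ [a]) v) := by
  induction u, v using word_pair_induction with
  | nil_left v => simpa using shuffleWord_singleton_snoc a b v
  | nil_right u =>
    rw [List.nil_append, shuffleWord_comm, shuffleWord_singleton_snoc, shuffleWord_nil_right,
      shuffleWord_comm u, add_comm]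
  | cons_cons c u d v h1 h2 =>
    simp only [List.cons_append] at *
    rw [shuffleWord_cons_cons, h1, h2, shuffleWord_cons_cons c d u (v ++ [b]),
      shuffleWord_cons_cons c d (u ++ [a]) v]
    simp only [map_add, snocMap_consMap]
    abel

theorem tau_shuffle (x y : ShuffleAlg) : tau (shuffle x y) = shuffle (tau x) (tau y) := by
  induction x using word_induction with
  | zero => simp
  | add x y hx hy => simp only [shuffle_add_left, map_add, hx, hy]
  | smul a x hx => simp only [shuffle_smul_left, map_smul, hx]
  | basis u =>
    induction y using word_induction with
    | zero => simp
    | add x y hx hy => simp only [shuffle_add_right, map_add, hx, hy]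
    | smul a x hx => simp only [shuffle_smul_right, map_smul, hx]
    | basis v =>
      simp only [shuffle_word, tau_word]
      induction u, v using word_pair_induction with
      | nil_left v => simp
      | nil_right u => simp
      | cons_cons a u b v h1 h2 =>
        rw [shuffleWord_cons_cons, map_add, tau_consMap, tau_consMap, h1, h2]
        simp only [List.map_cons, List.reverse_cons, shuffleWord_snoc_snoc]

/-! ### Derivations -/

/-- The left derivation `ξ_a u ↦ u`, killing the other words. -/
noncomputable def dL (a : Fin 2) : ShuffleAlg →ₗ[ℂ] ShuffleAlg :=
  Finsupp.lcomapDomain (List.cons a) List.cons_injective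

/-- The right derivation `u ξ₀ ↦ u`, killing the other words. -/
noncomputable def dR : ShuffleAlg →ₗ[ℂ] ShuffleAlg :=
  Finsupp.lcomapDomain (fun w => w ++ [0]) (List.append_left_injective _)

theorem dL_apply (a : Fin 2) (x : ShuffleAlg) (w : Word) : dL a x w = x (a :: w) := rfl

theorem dR_apply (x : ShuffleAlg) (w : Word) : dR x w = x (w ++ [0]) := rfl

theorem tau_apply (x : ShuffleAlg) (w : Word) : tau x w = x (w.map Fin.rev).reverse := by
  have hinj : Function.Injective fun w : Word => (w.map Fin.rev).reverse := fun a b h => by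
    have h' : (a.map Fin.rev) = b.map Fin.rev := List.reverse_injective h
    exact List.map_injective_iff.2 Fin.rev_injective h'
  have := Finsupp.mapDomain_apply hinj x (w.map Fin.rev).reverse
  simp only [List.map_reverse, List.reverse_reverse, List.map_map, Function.comp_def, Fin.rev_rev,
    List.map_id'] at this
  exact this

theorem dL_word_nil (a : Fin 2) : dL a (word []) = 0 := by
  ext w; simp [dL_apply, word]

theorem dL_word_cons (a b : Fin 2) (w : Word) :
    dL a (word (b :: w)) = if a = b then word w else 0 := by
  ext v
  rw [dL_apply, word, Finsupp.single_apply]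
  by_cases h : a = b
  · subst h; simp [word, Finsupp.single_apply]
  · simp [h, Ne.symm h]

theorem dL_consMap (a b : Fin 2) (x : ShuffleAlg) :
    dL a (consMap b x) = if a = b then x else 0 := by
  have h : dL a ∘ₗ consMap b = if a = b then LinearMap.id else 0 :=
    linearMap_ext_word fun w => by
      rw [LinearMap.comp_apply, consMap_word, dL_word_cons]
      split_ifs <;> rfl
  have := LinearMap.congr_fun h x
  rw [LinearMap.comp_apply] at this
  rw [this]; split_ifs <;> rfl

/-- The first letter of a shuffle comes from one of the two factors, which gives the Leibniz rule.
-/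
theorem dL_shuffle (a : Fin 2) (x y : ShuffleAlg) :
    dL a (shuffle x y) = shuffle (dL a x) y + shuffle x (dL a y) := by
  induction x using word_induction with
  | zero => simp
  | add x y hx hy => simp only [shuffle_add_left, map_add, hx, hy]; abel
  | smul a x hx => simp only [shuffle_smul_left, map_smul, hx, smul_add]
  | basis u =>
    induction y using word_induction with
    | zero => simp
    | add x y hx hy => simp only [shuffle_add_right, map_add, hx, hy]; abel
    | smul a x hx => simp only [shuffle_smul_right, map_smul, hx, smul_add]
    | basis v =>
      cases u with
      | nil => simp [dL_word_nil]
      | cons b u =>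
        cases v with
        | nil => simp [dL_word_nil]
        | cons c v =>
          rw [shuffle_word, shuffleWord_cons_cons, map_add, dL_consMap, dL_consMap, dL_word_cons,
            dL_word_cons]
          split_ifs <;> simp [shuffle_word]

/-- `tau` turns a final ξ₀ into an initial ξ₁, so the Leibniz rule for `dR` is inherited from `dL`.
-/
theorem dR_eq (x : ShuffleAlg) : dR x = tau (dL 1 (tau x)) := by
  ext w
  simp [tau_apply, dL_apply, dR_apply, Function.comp_def]

theorem dR_shuffle (x y : ShuffleAlg) :
    dR (shuffle x y) = shuffle (dR x) y + shuffle x (dR y) := by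
  simp only [dR_eq, tau_shuffle, dL_shuffle, map_add, tau_tau]

theorem dL_dR (x : ShuffleAlg) (a : Fin 2) : dL a (dR x) = dR (dL a x) := by
  ext w; rfl

theorem dL_iterate_apply (a : Fin 2) (n : ℕ) (x : ShuffleAlg) (w : Word) :
    ((dL a)^[n] x) w = x (List.replicate n a ++ w) := by
  induction n generalizing w with
  | zero => rfl
  | succ n ih => rw [Function.iterate_succ_apply', dL_apply, ih, List.replicate_succ']; simp

theorem dR_iterate_apply (n : ℕ) (x : ShuffleAlg) (w : Word) :
    (dR^[n] x) w = x (w ++ List.replicate n 0) := by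
  induction n generalizing w with
  | zero => simp
  | succ n ih => rw [Function.iterate_succ_apply', dR_apply, ih, List.replicate_succ]; simp

/-- As the kernel of a derivation, `S0` is closed under shuffles, and `dR` plays the role of d/dξ₀
on S⁰[ξ₀]. -/
theorem mem_S0_iff (x : ShuffleAlg) : x ∈ S0 ↔ dR x = 0 := by
  rw [S0, Finsupp.mem_supported']
  constructor
  · intro h
    ext w
    rw [dR_apply]
    refine h _ ?_
    rintro (h | ⟨v, h⟩)
    · simp at h
    · have := (List.append_inj' h rfl).2
      simp at this
  · intro h w hw
    rcases List.eq_nil_or_concat w with rfl | ⟨v, a, rfl⟩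
    · exact absurd (Or.inl rfl) hw
    · have ha : a = 0 := by
        by_contra ha
        exact hw (Or.inr ⟨v, by simp; omega⟩)
      subst ha
      have := DFunLike.congr_fun h v
      simpa [dR_apply] using this

theorem mem_S10_iff (x : ShuffleAlg) : x ∈ S10 ↔ dR x = 0 ∧ dL 1 x = 0 := by
  rw [S10, Finsupp.mem_supported']
  constructor
  · intro h
    refine ⟨?_, ?_⟩
    · rw [← mem_S0_iff, S0, Finsupp.mem_supported']
      intro w hw
      refine h w fun h => hw ?_
      rcases h with h | ⟨v, rfl⟩
      · exact Or.inl h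
      · exact Or.inr ⟨0 :: v, by simp⟩
    · ext w
      refine h _ ?_
      rintro (h | ⟨v, h⟩) <;> simp at h
  · rintro ⟨h, h'⟩ w hw
    rw [← mem_S0_iff, S0, Finsupp.mem_supported'] at h
    by_cases hw0 : w = [] ∨ ∃ v : Word, w = v ++ [1]
    · rcases hw0 with rfl | ⟨v, rfl⟩
      · exact absurd (Or.inl rfl) hw
      · cases v with
        | nil => exact DFunLike.congr_fun h' []
        | cons b v =>
          have hb : b = 1 := by
            by_contra hb
            exact hw (Or.inr ⟨v, by simp; omega⟩)
          subst hb
          exact DFunLike.congr_fun h' (v ++ [1])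
    · exact h w hw0

/-! ### Powers of a letter -/

theorem dL_replicate_succ (a : Fin 2) (n : ℕ) :
    dL a (word (List.replicate (n + 1) a)) = word (List.replicate n a) := by
  rw [List.replicate_succ, dL_word_cons, if_pos rfl]

theorem dL_replicate_of_ne {a b : Fin 2} (h : a ≠ b) (n : ℕ) :
    dL a (word (List.replicate n b)) = 0 := by
  cases n with
  | zero => exact dL_word_nil a
  | succ n => rw [List.replicate_succ, dL_word_cons, if_neg h]

theorem dR_replicate_zero_succ (n : ℕ) :
    dR (word (List.replicate (n + 1) 0)) = word (List.replicate n 0) := by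
  have h : Fin.rev (0 : Fin 2) = 1 := rfl
  have h' : Fin.rev (1 : Fin 2) = 0 := rfl
  rw [dR_eq, tau_word, List.map_replicate, List.reverse_replicate, h, dL_replicate_succ,
    tau_word, List.map_replicate, List.reverse_replicate, h']

theorem dR_replicate_one (n : ℕ) : dR (word (List.replicate n 1)) = 0 := by
  have h' : Fin.rev (1 : Fin 2) = 0 := rfl
  rw [dR_eq, tau_word, List.map_replicate, List.reverse_replicate, h',
    dL_replicate_of_ne (by decide), map_zero]

/-- The words aⁿ behave as divided powers: n! aⁿ is the n-th shuffle power of a. This is the source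
of the factorials in log^j z / j!. -/
theorem shuffleWord_replicate (a : Fin 2) (m n : ℕ) :
    shuffleWord (List.replicate m a) (List.replicate n a) =
      ((m + n).choose m : ℂ) • word (List.replicate (m + n) a) := by
  induction m generalizing n with
  | zero => simp
  | succ m ihm =>
    induction n with
    | zero => simp
    | succ n ihn =>
      have h1 : m + (n + 1) = m + n + 1 := rfl
      have h2 : m + 1 + n = m + n + 1 := by omega
      have h3 : m + 1 + (n + 1) = m + n + 1 + 1 := by omega
      have ihm' := ihm (n + 1)
      rw [List.replicate_succ, h1] at ihm'
      rw [List.replicate_succ, h2] at ihn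
      rw [List.replicate_succ, List.replicate_succ, shuffleWord_cons_cons, ihm', ihn, h3]
      simp only [map_smul, consMap_word]
      rw [← add_smul, Nat.choose_succ_succ (m + n + 1) m]
      push_cast
      rfl

theorem IsShuffleHom.map_replicate {φ : ShuffleAlg →ₗ[ℂ] ℂ} (hφ : IsShuffleHom φ) (a : Fin 2)
    (n : ℕ) : φ (word (List.replicate n a)) = φ (word [a]) ^ n / (n.factorial : ℂ) := by
  induction n with
  | zero => simp [hφ.map_one]
  | succ n ih =>
    have h := hφ.map_shuffle (word (List.replicate 1 a)) (word (List.replicate n a))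
    rw [shuffle_word, shuffleWord_replicate, map_smul, ih, smul_eq_mul, Nat.choose_one_right,
      add_comm 1 n] at h
    have hn : ((n + 1 : ℕ) : ℂ) ≠ 0 := by exact_mod_cast n.succ_ne_zero
    have hf : (n.factorial : ℂ) ≠ 0 := by exact_mod_cast n.factorial_ne_zero
    rw [Nat.factorial_succ]
    push_cast at *
    field_simp at h ⊢
    rw [h]; ring

/-! ### The grading by length -/

theorem supported_induction {s : Set Word} {p : ShuffleAlg → Prop} {x : ShuffleAlg}
    (hx : x ∈ Finsupp.supported ℂ ℂ s) (zero : p 0) (add : ∀ x y, p x → p y → p (x + y))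
    (smul : ∀ (a : ℂ) x, p x → p (a • x)) (basis : ∀ w ∈ s, p (word w)) : p x := by
  rw [Finsupp.supported_eq_span_single] at hx
  induction hx using Submodule.span_induction with
  | mem x h => obtain ⟨w, hw, rfl⟩ := h; exact basis w hw
  | zero => exact zero
  | add x y _ _ hx hy => exact add x y hx hy
  | smul a x _ hx => exact smul a x hx

/-- The homogeneous part of degree `m` of `S`. -/
noncomputable def homogeneous (m : ℕ) : Submodule ℂ ShuffleAlg :=
  Finsupp.supported ℂ ℂ {w : Word | w.length = m}

theorem mem_homogeneous {m : ℕ} {x : ShuffleAlg} :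
    x ∈ homogeneous m ↔ ∀ w : Word, w.length ≠ m → x w = 0 := by
  rw [homogeneous, Finsupp.mem_supported']; rfl

theorem word_mem_homogeneous (w : Word) : word w ∈ homogeneous w.length :=
  Finsupp.single_mem_supported ℂ _ rfl

theorem consMap_mem_homogeneous {m : ℕ} {x : ShuffleAlg} (a : Fin 2) (hx : x ∈ homogeneous m) :
    consMap a x ∈ homogeneous (m + 1) := by
  refine supported_induction (p := fun x => consMap a x ∈ homogeneous (m + 1)) hx ?_ ?_ ?_ ?_
  · simp
  · intro x y hx hy; rw [map_add]; exact add_mem hx hy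
  · intro c x hx; rw [map_smul]; exact Submodule.smul_mem _ _ hx
  · rintro w rfl; rw [consMap_word]; exact word_mem_homogeneous (a :: w)

theorem shuffleWord_mem_homogeneous (u v : Word) :
    shuffleWord u v ∈ homogeneous (u.length + v.length) := by
  induction u, v using word_pair_induction with
  | nil_left v => simpa using word_mem_homogeneous v
  | nil_right u => simpa using word_mem_homogeneous u
  | cons_cons a u b v h1 h2 =>
    rw [shuffleWord_cons_cons]
    refine add_mem ?_ (consMap_mem_homogeneous b h2)
    have := consMap_mem_homogeneous a h1
    have e : (a :: u).length + (b :: v).length = u.length + (b :: v).length + 1 := by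
      simp only [List.length_cons]; omega
    rwa [e]

theorem shuffle_mem_homogeneous {m n : ℕ} {x y : ShuffleAlg} (hx : x ∈ homogeneous m)
    (hy : y ∈ homogeneous n) : shuffle x y ∈ homogeneous (m + n) := by
  refine supported_induction (p := fun x => shuffle x y ∈ homogeneous (m + n)) hx ?_ ?_ ?_ ?_
  · simp
  · intro x y hx hy; rw [shuffle_add_left]; exact add_mem hx hy
  · intro c x hx; rw [shuffle_smul_left]; exact Submodule.smul_mem _ _ hx
  · rintro u rfl
    refine supported_induction
      (p := fun y => shuffle (word u) y ∈ homogeneous (u.length + n)) hy ?_ ?_ ?_ ?_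
    · simp
    · intro x y hx hy; rw [shuffle_add_right]; exact add_mem hx hy
    · intro c x hx; rw [shuffle_smul_right]; exact Submodule.smul_mem _ _ hx
    · rintro v rfl
      rw [shuffle_word]
      exact shuffleWord_mem_homogeneous u v

theorem dR_iterate_mem_homogeneous {m n : ℕ} (hn : n ≤ m) {x : ShuffleAlg}
    (hx : x ∈ homogeneous m) : dR^[n] x ∈ homogeneous (m - n) := by
  rw [mem_homogeneous] at *
  intro w hw
  rw [dR_iterate_apply]
  refine hx _ ?_
  simp only [List.length_append, List.length_replicate]
  omega

theorem dR_iterate_eq_zero {m n : ℕ} (hn : m < n) {x : ShuffleAlg}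
    (hx : x ∈ homogeneous m) : dR^[n] x = 0 := by
  rw [mem_homogeneous] at hx
  ext w
  rw [dR_iterate_apply]
  refine hx _ ?_
  simp only [List.length_append, List.length_replicate]
  omega

/-- Local nilpotence, which makes the extraction of powers of ξ₁ terminate. -/
theorem exists_dL_iterate_eq_zero (a : Fin 2) (x : ShuffleAlg) : ∃ n, (dL a)^[n] x = 0 := by
  induction x using word_induction with
  | zero => exact ⟨0, rfl⟩
  | add x y hx hy =>
    obtain ⟨m, hm⟩ := hx
    obtain ⟨n, hn⟩ := hy
    refine ⟨m + n, ?_⟩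
    rw [iterate_map_add, Function.iterate_add_apply _ m n y, hn, add_comm m n,
      Function.iterate_add_apply _ n m x, hm, iterate_map_zero, iterate_map_zero, add_zero]
  | smul c x hx =>
    obtain ⟨n, hn⟩ := hx
    refine ⟨n, ?_⟩
    rw [← Module.End.pow_apply, map_smul, Module.End.pow_apply, hn, smul_zero]
  | basis w =>
    refine ⟨w.length + 1, ?_⟩
    ext v
    rw [dL_iterate_apply]
    refine mem_homogeneous.1 (word_mem_homogeneous w) _ ?_
    simp only [List.length_append, List.length_replicate]
    omega

/-! ### The polynomial representation `S = S⁰[ξ₀]` -/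

theorem word_nil_mem_S0 : word [] ∈ S0 := by
  rw [mem_S0_iff]; ext w; simp [dR_apply, word]

theorem shuffle_mem_S0 {x y : ShuffleAlg} (hx : x ∈ S0) (hy : y ∈ S0) : shuffle x y ∈ S0 := by
  rw [mem_S0_iff] at *
  rw [dR_shuffle, hx, hy]; simp

theorem dL_mem_S0 {x : ShuffleAlg} (a : Fin 2) (hx : x ∈ S0) : dL a x ∈ S0 := by
  rw [mem_S0_iff] at *
  rw [← dL_dR, hx, map_zero]

theorem dR_iterate_shuffle {v : ShuffleAlg} (hv : v ∈ S0) (k j : ℕ) :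
    dR^[k] (shuffle v (word (List.replicate j 0))) =
      if j < k then 0 else shuffle v (word (List.replicate (j - k) 0)) := by
  rw [mem_S0_iff] at hv
  induction k with
  | zero => simp
  | succ k ih =>
    rw [Function.iterate_succ_apply', ih]
    by_cases h1 : j < k
    · rw [if_pos h1, if_pos (by omega), map_zero]
    · rw [if_neg h1, dR_shuffle, hv, shuffle_zero_left, zero_add]
      by_cases h2 : j < k + 1
      · have : j - k = 0 := by omega
        rw [if_pos h2, this]
        have h0 := (mem_S0_iff _).1 word_nil_mem_S0
        rw [List.replicate_zero, h0, shuffle_zero_right]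
      · obtain ⟨i, hi⟩ : ∃ i, j - k = i + 1 := ⟨j - k - 1, by omega⟩
        have : j - (k + 1) = i := by omega
        rw [if_neg h2, hi, this, dR_replicate_zero_succ]

/-- The evaluation `∑ⱼ cⱼ ⧢ ξ₀ʲ`. -/
noncomputable def eval0 : (ℕ →₀ ShuffleAlg) →ₗ[ℂ] ShuffleAlg :=
  Finsupp.lsum ℂ fun j => shuffleBilin.flip (word (List.replicate j 0))

theorem eval0_apply (c : ℕ →₀ ShuffleAlg) :
    eval0 c = c.sum fun j v => shuffle v (word (List.replicate j 0)) := by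
  simp only [eval0, shuffle_eq, Finsupp.coe_lsum]
  rfl

theorem eval0_single (j : ℕ) (v : ShuffleAlg) :
    eval0 (Finsupp.single j v) = shuffle v (word (List.replicate j 0)) := by
  rw [eval0_apply, Finsupp.sum_single_index (by simp)]

theorem isPoly0_iff {u : ShuffleAlg} {c : ℕ →₀ ShuffleAlg} :
    IsPoly0 u c ↔ (∀ j, c j ∈ S0) ∧ u = eval0 c := by
  rw [IsPoly0, eval0_apply]

theorem isPoly0_single {v : ShuffleAlg} (hv : v ∈ S0) (j : ℕ) :
    IsPoly0 (shuffle v (word (List.replicate j 0))) (Finsupp.single j v) := by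
  refine isPoly0_iff.2 ⟨fun i => ?_, (eval0_single j v).symm⟩
  rw [Finsupp.single_apply]
  split_ifs
  exacts [hv, zero_mem _]

theorem IsPoly0.add {u v : ShuffleAlg} {c d : ℕ →₀ ShuffleAlg} (hc : IsPoly0 u c)
    (hd : IsPoly0 v d) : IsPoly0 (u + v) (c + d) := by
  rw [isPoly0_iff] at *
  exact ⟨fun j => add_mem (hc.1 j) (hd.1 j), by rw [hc.2, hd.2, map_add]⟩

theorem IsPoly0.smul {u : ShuffleAlg} {c : ℕ →₀ ShuffleAlg} (a : ℂ) (hc : IsPoly0 u c) :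
    IsPoly0 (a • u) (a • c) := by
  rw [isPoly0_iff] at *
  exact ⟨fun j => Submodule.smul_mem _ a (hc.1 j), by rw [hc.2, map_smul]⟩

/-- Applying d/dξ₀ as often as the top degree J isolates the leading coefficient; no factorial
appears because ξ₀ʲ is a divided power. -/
theorem IsPoly0.eq_zero {c : ℕ →₀ ShuffleAlg} (hc : IsPoly0 0 c) : c = 0 := by
  by_contra hne
  obtain ⟨hS, h0⟩ := isPoly0_iff.1 hc
  have hsupp := Finsupp.support_nonempty_iff.2 hne
  set J := c.support.max' hsupp with hJ
  have hJm : J ∈ c.support := Finset.max'_mem _ _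
  have h1 : dR^[J] (eval0 c) = c J := by
    rw [eval0_apply, Finsupp.sum, ← Module.End.pow_apply, map_sum, Finset.sum_eq_single_of_mem J hJm]
    · rw [Module.End.pow_apply, dR_iterate_shuffle (hS J)]; simp
    · intro j hj hne
      have : j ≤ J := Finset.le_max' _ _ hj
      rw [Module.End.pow_apply, dR_iterate_shuffle (hS j), if_pos (by omega)]
  rw [← h0, iterate_map_zero] at h1
  exact (Finsupp.mem_support_iff.1 hJm) h1.symm

theorem IsPoly0.unique {u : ShuffleAlg} {c d : ℕ →₀ ShuffleAlg} (hc : IsPoly0 u c)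
    (hd : IsPoly0 u d) : c = d := by
  have h := hc.add (hd.smul (-1))
  rw [neg_one_smul ℂ u, neg_one_smul ℂ d, ← sub_eq_add_neg, ← sub_eq_add_neg, sub_self] at h
  exact sub_eq_zero.1 h.eq_zero

/-- The leading coefficient is dRⁿ⁺¹u in the inductive step; subtracting its term lowers the degree
in ξ₀. The degrees of the coefficients are recorded because uniqueness is proved by induction on
word length. -/
theorem exists_isPoly0_of_iterate {m : ℕ} (n : ℕ) (hn : n ≤ m) (u : ShuffleAlg)
    (hu : u ∈ homogeneous m) (h : dR^[n + 1] u = 0) :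
    ∃ c, IsPoly0 u c ∧ (∀ j ≤ m, c j ∈ homogeneous (m - j)) ∧ ∀ j > m, c j = 0 := by
  induction n generalizing u with
  | zero =>
    refine ⟨Finsupp.single 0 u, ?_, fun j hj => ?_, fun j hj => ?_⟩
    · simpa using isPoly0_single ((mem_S0_iff u).2 h) 0
    · rw [Finsupp.single_apply]
      split_ifs with h0
      · subst h0; exact hu
      · exact zero_mem _
    · rw [Finsupp.single_apply, if_neg (by omega)]
  | succ n ih =>
    set v := dR^[n + 1] u with hv
    have hvS : v ∈ S0 := by
      rw [mem_S0_iff, hv, ← Function.iterate_succ_apply' dR]; exact h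
    have hvm : v ∈ homogeneous (m - (n + 1)) := dR_iterate_mem_homogeneous hn hu
    have hmem : shuffle v (word (List.replicate (n + 1) 0)) ∈ homogeneous m := by
      have := shuffle_mem_homogeneous hvm (word_mem_homogeneous (List.replicate (n + 1) 0))
      rwa [List.length_replicate, Nat.sub_add_cancel hn] at this
    obtain ⟨c, hc, hcm, hc0⟩ := ih (by omega) (u - shuffle v (word (List.replicate (n + 1) 0)))
      (sub_mem hu hmem) (by
        rw [iterate_map_sub, dR_iterate_shuffle hvS, if_neg (lt_irrefl _), ← hv]; simp)
    refine ⟨c + Finsupp.single (n + 1) v, ?_, fun j hj => ?_, fun j hj => ?_⟩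
    · simpa using hc.add (isPoly0_single hvS (n + 1))
    · rw [Finsupp.add_apply, Finsupp.single_apply]
      refine add_mem (hcm j hj) ?_
      split_ifs with h0
      · subst h0; exact hvm
      · exact zero_mem _
    · rw [Finsupp.add_apply, Finsupp.single_apply, if_neg (by omega), hc0 j hj, add_zero]

theorem exists_isPoly0_word (w : Word) :
    ∃ c, IsPoly0 (word w) c ∧ (∀ j ≤ w.length, c j ∈ homogeneous (w.length - j)) ∧
      ∀ j > w.length, c j = 0 :=
  exists_isPoly0_of_iterate w.length le_rfl _ (word_mem_homogeneous w)
    (dR_iterate_eq_zero (Nat.lt_succ_self _) (word_mem_homogeneous w))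

theorem exists_isPoly0 (u : ShuffleAlg) : ∃ c, IsPoly0 u c := by
  induction u using word_induction with
  | zero => exact ⟨0, isPoly0_iff.2 ⟨fun _ => zero_mem _, by simp⟩⟩
  | add x y hx hy => obtain ⟨c, hc⟩ := hx; obtain ⟨d, hd⟩ := hy; exact ⟨_, hc.add hd⟩
  | smul a x hx => obtain ⟨c, hc⟩ := hx; exact ⟨_, hc.smul a⟩
  | basis w => obtain ⟨c, hc, _⟩ := exists_isPoly0_word w; exact ⟨c, hc⟩

theorem isPoly0_coeff0 (u : ShuffleAlg) : IsPoly0 u (coeff0 u) := by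
  have h := exists_isPoly0 u
  rw [coeff0, dif_pos h]; exact h.choose_spec

theorem IsPoly0.coeff0_eq {u : ShuffleAlg} {c : ℕ →₀ ShuffleAlg} (hc : IsPoly0 u c) :
    coeff0 u = c := (isPoly0_coeff0 u).unique hc

theorem coeff0_add (u v : ShuffleAlg) : coeff0 (u + v) = coeff0 u + coeff0 v :=
  ((isPoly0_coeff0 u).add (isPoly0_coeff0 v)).coeff0_eq

theorem coeff0_smul (a : ℂ) (u : ShuffleAlg) : coeff0 (a • u) = a • coeff0 u :=
  ((isPoly0_coeff0 u).smul a).coeff0_eq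

theorem coeff0_shuffle_replicate {v : ShuffleAlg} (hv : v ∈ S0) (j : ℕ) :
    coeff0 (shuffle v (word (List.replicate j 0))) = Finsupp.single j v :=
  (isPoly0_single hv j).coeff0_eq

theorem reg0_mem_S0 (u : ShuffleAlg) : reg0 u ∈ S0 := (isPoly0_coeff0 u).1 0

theorem coeff0_word_mem_homogeneous {w : Word} {j : ℕ} (hj : j ≤ w.length) :
    coeff0 (word w) j ∈ homogeneous (w.length - j) := by
  obtain ⟨c, hc, h, _⟩ := exists_isPoly0_word w
  rw [hc.coeff0_eq]; exact h j hj

theorem coeff0_word_eq_zero {w : Word} {j : ℕ} (hj : w.length < j) : coeff0 (word w) j = 0 := by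
  obtain ⟨c, hc, _, h⟩ := exists_isPoly0_word w
  rw [hc.coeff0_eq]; exact h j hj

/-- Induction along the representation `S = S⁰[ξ₀]`. -/
theorem poly0_induction {p : ShuffleAlg → Prop} (u : ShuffleAlg) (zero : p 0)
    (add : ∀ x y, p x → p y → p (x + y))
    (basis : ∀ v ∈ S0, ∀ j, p (shuffle v (word (List.replicate j 0)))) : p u := by
  obtain ⟨hS, h⟩ := isPoly0_coeff0 u
  rw [h]
  exact Finset.sum_induction _ p add zero fun j _ => basis _ (hS j) j

/-! ### The polynomial representation `S = S¹⁰[ξ₀, ξ₁]` -/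

theorem IsPoly10.add {u v : ShuffleAlg} {c d : ℕ × ℕ →₀ ShuffleAlg} (hc : IsPoly10 u c)
    (hd : IsPoly10 v d) : IsPoly10 (u + v) (c + d) := by
  refine ⟨fun j => add_mem (hc.1 j) (hd.1 j), ?_⟩
  rw [hc.2, hd.2, Finsupp.sum_add_index' (by simp)]
  intro a b₁ b₂
  rw [shuffle_add_right, shuffle_add_left]

theorem isPoly10_single {v : ShuffleAlg} (hv : v ∈ S10) (i j : ℕ) :
    IsPoly10 (shuffle (shuffle (word (List.replicate i 1)) v) (word (List.replicate j 0)))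
      (Finsupp.single (i, j) v) := by
  refine ⟨fun p => ?_, by rw [Finsupp.sum_single_index (by simp)]⟩
  rw [Finsupp.single_apply]
  split_ifs
  exacts [hv, zero_mem _]

theorem dL_iterate_mem_S0 {x : ShuffleAlg} (a : Fin 2) (n : ℕ) (hx : x ∈ S0) :
    (dL a)^[n] x ∈ S0 := by
  induction n with
  | zero => exact hx
  | succ n ih => rw [Function.iterate_succ_apply']; exact dL_mem_S0 a ih

theorem dL_iterate_replicate_shuffle {v : ShuffleAlg} (hv : dL 1 v = 0) (k : ℕ) :
    (dL 1)^[k] (shuffle (word (List.replicate k 1)) v) = v := by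
  induction k with
  | zero => simp
  | succ k ih =>
    rw [Function.iterate_succ_apply, dL_shuffle, hv, shuffle_zero_right, add_zero,
      dL_replicate_succ, ih]

/-- The leading-term extraction is repeated inside `S0`, now with `dL 1` as d/dξ₁. The top
coefficient lies in both kernels, that is, in `S10`. -/
theorem exists_isPoly10_of_iterate (j n : ℕ) (v : ShuffleAlg) (hv : v ∈ S0)
    (h : (dL 1)^[n] v = 0) : ∃ c, IsPoly10 (shuffle v (word (List.replicate j 0))) c := by
  induction n generalizing v with
  | zero =>
    rw [Function.iterate_zero, id] at h
    subst h
    exact ⟨0, fun _ => zero_mem _, by simp⟩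
  | succ n ih =>
    set x := (dL 1)^[n] v with hx
    have hx1 : dL 1 x = 0 := by rw [hx, ← Function.iterate_succ_apply' (dL 1)]; exact h
    have hx0 : x ∈ S0 := dL_iterate_mem_S0 1 n hv
    have hx10 : x ∈ S10 := (mem_S10_iff x).2 ⟨(mem_S0_iff x).1 hx0, hx1⟩
    have hone : word (List.replicate n 1) ∈ S0 := (mem_S0_iff _).2 (dR_replicate_one n)
    obtain ⟨c, hc⟩ := ih (v - shuffle (word (List.replicate n 1)) x)
      (sub_mem hv (shuffle_mem_S0 hone hx0)) (by
        rw [iterate_map_sub, dL_iterate_replicate_shuffle hx1, ← hx, sub_self])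
    have := hc.add (isPoly10_single hx10 n j)
    rw [← shuffle_add_left, sub_add_cancel] at this
    exact ⟨_, this⟩

theorem exists_isPoly10 (u : ShuffleAlg) : ∃ c, IsPoly10 u c := by
  induction u using poly0_induction with
  | zero => exact ⟨0, fun _ => zero_mem _, by simp⟩
  | add x y hx hy => obtain ⟨c, hc⟩ := hx; obtain ⟨d, hd⟩ := hy; exact ⟨_, hc.add hd⟩
  | basis v hv j =>
    obtain ⟨n, hn⟩ := exists_dL_iterate_eq_zero 1 v
    exact exists_isPoly10_of_iterate j n v hv hn

theorem isPoly10_coeff10 (u : ShuffleAlg) : IsPoly10 u (coeff10 u) := by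
  have h := exists_isPoly10 u
  rw [coeff10, dif_pos h]; exact h.choose_spec

theorem reg10_mem_S10 (u : ShuffleAlg) : reg10 u ∈ S10 := (isPoly10_coeff10 u).1 (0, 0)

/-- Every term of positive degree in ξ₀ or ξ₁ contains a factor that φ kills. The argument applies
to whichever representation `coeff10` selects, so only existence is needed. -/
theorem IsShuffleHom.map_reg10 {φ : ShuffleAlg →ₗ[ℂ] ℂ} (hφ : IsShuffleHom φ)
    (h0 : φ (word [0]) = 0) (h1 : φ (word [1]) = 0) (u : ShuffleAlg) : φ (reg10 u) = φ u := by
  conv_rhs => rw [(isPoly10_coeff10 u).2, Finsupp.sum, map_sum]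
  have hterm : ∀ p : ℕ × ℕ, φ (shuffle (shuffle (word (List.replicate p.1 1)) (coeff10 u p))
      (word (List.replicate p.2 0))) = if p = (0, 0) then φ (reg10 u) else 0 := by
    rintro ⟨i, j⟩
    rw [hφ.map_shuffle, hφ.map_shuffle, hφ.map_replicate, hφ.map_replicate, h0, h1]
    rcases i with _ | i
    · rcases j with _ | j
      · simp [reg10]
      · simp
    · simp
  simp only [hterm]
  rw [Finset.sum_ite_eq']
  split_ifs with h
  · rfl
  · rw [reg10, Finsupp.notMem_support_iff.1 h, map_zero]

/-! ### Convolution of shuffle homomorphisms -/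

/-- The convolution product of linear forms with respect to deconcatenation, on words. -/
noncomputable def convWord (α β : Word → ℂ) (w : Word) : ℂ :=
  ∑ k ∈ Finset.range (w.length + 1), α (w.take k) * β (w.drop k)

theorem convWord_nil (α β : Word → ℂ) : convWord α β [] = α [] * β [] := by simp [convWord]

theorem convWord_cons (α β : Word → ℂ) (a : Fin 2) (w : Word) :
    convWord α β (a :: w) = α [] * β (a :: w) + convWord (fun u => α (a :: u)) β w := by
  rw [convWord, List.length_cons, Finset.sum_range_succ', add_comm]
  simp [convWord]

/-- The linear form on `S` with given values on words. -/
noncomputable def ofWords (α : Word → ℂ) : ShuffleAlg →ₗ[ℂ] ℂ := Finsupp.linearCombination ℂ α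

@[simp] theorem ofWords_word (α : Word → ℂ) (w : Word) : ofWords α (word w) = α w := by
  simp [ofWords, word]

theorem ofWords_consMap (α : Word → ℂ) (a : Fin 2) (x : ShuffleAlg) :
    ofWords α (consMap a x) = ofWords (fun u => α (a :: u)) x := by
  have h : ofWords α ∘ₗ consMap a = ofWords fun u => α (a :: u) := linearMap_ext_word (by simp)
  exact LinearMap.congr_fun h x

theorem ofWords_convWord_consMap (α β : Word → ℂ) (a : Fin 2) (x : ShuffleAlg) :
    ofWords (convWord α β) (consMap a x) = α [] * ofWords β (consMap a x) +
      ofWords (convWord (fun u => α (a :: u)) β) x := by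
  have h : ofWords (convWord α β) ∘ₗ consMap a = α [] • (ofWords β ∘ₗ consMap a) +
      ofWords (convWord (fun u => α (a :: u)) β) :=
    linearMap_ext_word (by simp [convWord_cons])
  exact LinearMap.congr_fun h x

/-- Deconcatenation is multiplicative for the shuffle product. -/
theorem ofWords_convWord_shuffleWord (α β : Word → ℂ) (u v : Word) :
    ofWords (convWord α β) (shuffleWord u v) =
      ∑ k ∈ Finset.range (u.length + 1), ∑ l ∈ Finset.range (v.length + 1),
        ofWords α (shuffleWord (u.take k) (v.take l)) *
          ofWords β (shuffleWord (u.drop k) (v.drop l)) := by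
  -- The form α must vary: a letter that falls into the left factor replaces α by α(a ·).
  induction u, v using word_pair_induction generalizing α with
  | nil_left v => simp [convWord]
  | nil_right u => simp [convWord]
  | cons_cons a u b v h1 h2 =>
    rw [shuffleWord_cons_cons, map_add, ofWords_convWord_consMap, ofWords_convWord_consMap, h1, h2]
    simp only [List.length_cons, Finset.sum_range_succ' _ (u.length + 1),
      Finset.sum_range_succ' _ (v.length + 1), List.take_succ_cons, List.drop_succ_cons,
      List.take_zero, List.drop_zero, shuffleWord_nil_left, shuffleWord_nil_right,
      shuffleWord_cons_cons, map_add, ofWords_consMap, ofWords_word, Finset.sum_add_distrib,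
      add_mul, mul_add]
    ring

theorem isShuffleHom_of_words {φ : ShuffleAlg →ₗ[ℂ] ℂ} (h1 : φ (word []) = 1)
    (h : ∀ u v, φ (shuffleWord u v) = φ (word u) * φ (word v)) : IsShuffleHom φ := by
  refine ⟨h1, fun x y => ?_⟩
  induction x using word_induction with
  | zero => simp
  | add x y hx hy => rw [shuffle_add_left, map_add, map_add, hx, hy, add_mul]
  | smul a x hx => rw [shuffle_smul_left, map_smul, map_smul, hx, smul_eq_mul, smul_eq_mul, mul_assoc]
  | basis u =>
    induction y using word_induction with
    | zero => simp
    | add x y hx hy => rw [shuffle_add_right, map_add, map_add, hx, hy, mul_add]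
    | smul a x hx =>
      rw [shuffle_smul_right, map_smul, map_smul, hx, smul_eq_mul, smul_eq_mul, mul_left_comm]
    | basis v => rw [shuffle_word, h]

theorem ofWords_comp_word (φ : ShuffleAlg →ₗ[ℂ] ℂ) : ofWords (fun w => φ (word w)) = φ :=
  linearMap_ext_word (by simp)

theorem IsShuffleHom.conv {φ ψ : ShuffleAlg →ₗ[ℂ] ℂ} (hφ : IsShuffleHom φ)
    (hψ : IsShuffleHom ψ) :
    IsShuffleHom (ofWords (convWord (fun w => φ (word w)) fun w => ψ (word w))) := by
  refine isShuffleHom_of_words ?_ fun u v => ?_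
  · rw [ofWords_word, convWord_nil, hφ.map_one, hψ.map_one, one_mul]
  · rw [ofWords_convWord_shuffleWord, ofWords_word, ofWords_word, convWord, convWord,
      Finset.sum_mul_sum]
    refine Finset.sum_congr rfl fun k _ => Finset.sum_congr rfl fun l _ => ?_
    rw [ofWords_comp_word, ofWords_comp_word, ← shuffle_word, ← shuffle_word, hφ.map_shuffle,
      hψ.map_shuffle]
    ring

theorem IsShuffleHom.comp_tau {φ : ShuffleAlg →ₗ[ℂ] ℂ} (hφ : IsShuffleHom φ) :
    IsShuffleHom (φ ∘ₗ tau) :=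
  ⟨by simp [hφ.map_one], fun x y => by simp [tau_shuffle, hφ.map_shuffle]⟩

/-! ### The domains -/

theorem mem_D1_iff {z : ℂ} : z ∈ D1 ↔ z ∈ Complex.slitPlane := by
  rw [Complex.mem_slitPlane_iff, D1, Set.mem_ofPred_eq, not_and_or, not_le, or_comm]

theorem mem_D0_iff {z : ℂ} : z ∈ D0 ↔ 1 - z ∈ Complex.slitPlane := by
  rw [Complex.mem_slitPlane_iff, D0, Set.mem_ofPred_eq, not_and_or, not_le, or_comm]
  simp

theorem one_sub_mem_D0 {z : ℂ} : 1 - z ∈ D0 ↔ z ∈ D1 := by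
  rw [mem_D0_iff, mem_D1_iff, sub_sub_cancel]

theorem one_sub_mem_D1 {z : ℂ} : 1 - z ∈ D1 ↔ z ∈ D0 := by
  rw [mem_D0_iff, mem_D1_iff]

theorem one_sub_mem_inter {z : ℂ} (hz : z ∈ D0 ∩ D1) : 1 - z ∈ D0 ∩ D1 :=
  ⟨one_sub_mem_D0.2 hz.2, one_sub_mem_D1.2 hz.1⟩

theorem isOpen_D1 : IsOpen D1 := by
  have : D1 = Complex.slitPlane := Set.ext fun _ => mem_D1_iff
  rw [this]; exact Complex.isOpen_slitPlane

theorem isOpen_D0 : IsOpen D0 := by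
  have : D0 = (fun z : ℂ => 1 - z) ⁻¹' Complex.slitPlane := Set.ext fun _ => mem_D0_iff
  rw [this]; exact Complex.isOpen_slitPlane.preimage (by fun_prop)

theorem zero_mem_D0 : (0 : ℂ) ∈ D0 := by simp [D0]

theorem mul_mem_D0 {z : ℂ} (hz : z ∈ D0) {t : ℝ} (h0 : 0 ≤ t) (h1 : t ≤ 1) : (t : ℂ) * z ∈ D0 := by
  rintro ⟨him, hre⟩
  simp only [Complex.mul_im, Complex.mul_re, Complex.ofReal_re, Complex.ofReal_im, zero_mul,
    add_zero, sub_zero] at him hre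
  rcases mul_eq_zero.1 him with h | h
  · subst h; simp at hre; linarith
  · refine hz ⟨h, ?_⟩
    by_contra! hlt
    have h2 : t * z.re ≤ t * 1 := mul_le_mul_of_nonneg_left hlt.le h0
    have h3 : t = 1 := by linarith
    subst h3
    linarith

theorem one_sub_ne_zero_of_mem_D0 {z : ℂ} (hz : z ∈ D0) : 1 - z ≠ 0 :=
  Complex.slitPlane_ne_zero (mem_D0_iff.1 hz)

theorem ne_zero_of_mem_D1 {z : ℂ} (hz : z ∈ D1) : z ≠ 0 :=
  Complex.slitPlane_ne_zero (mem_D1_iff.1 hz)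

theorem isPreconnected_D0 : IsPreconnected D0 := by
  have : StarConvex ℝ 0 D0 := by
    rw [starConvex_zero_iff]
    intro z hz t h0 h1
    simpa using mul_mem_D0 hz h0 h1
  exact (this.isPathConnected zero_mem_D0).isConnected.isPreconnected

/-! ### Primitives on `D₀` -/

/-- Differentiate under the integral sign: the x-derivative of x h(tx) is h(tx) + t x h'(tx), which
is also the t-derivative of t h(tx), so integrating over [0, 1] gives h(x). -/
theorem hasDerivAt_segment_primitive {h : ℂ → ℂ} (hh : DifferentiableOn ℂ h D0) {z : ℂ}
    (hz : z ∈ D0) :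
    HasDerivAt (fun z : ℂ => ∫ t in (0 : ℝ)..1, z * h (t * z)) (h z) z := by
  set F' : ℂ → ℝ → ℂ := fun x t => h (t * x) + x * (t * deriv h (t * x)) with hF'
  have hderiv : DifferentiableOn ℂ (deriv h) D0 := hh.deriv isOpen_D0
  have hmul : ∀ t ∈ Set.Icc (0 : ℝ) 1, ∀ x ∈ D0, (t : ℂ) * x ∈ D0 :=
    fun t ht x hx => mul_mem_D0 hx ht.1 ht.2
  have hderivAt : ∀ x ∈ D0, HasDerivAt h (deriv h x) x := fun x hx =>
    (hh.differentiableAt (isOpen_D0.mem_nhds hx)).hasDerivAt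
  obtain ⟨ε, hε, hball⟩ := Metric.nhds_basis_closedBall.mem_iff.1 (isOpen_D0.mem_nhds hz)
  have hcontF' : ContinuousOn (fun p : ℝ × ℂ => F' p.2 p.1)
      (Set.Icc (0 : ℝ) 1 ×ˢ Metric.closedBall z ε) := by
    have hmaps : Set.MapsTo (fun p : ℝ × ℂ => (p.1 : ℂ) * p.2)
        (Set.Icc (0 : ℝ) 1 ×ˢ Metric.closedBall z ε) D0 :=
      fun p hp => hmul _ hp.1 _ (hball hp.2)
    have hc : ContinuousOn (fun p : ℝ × ℂ => (p.1 : ℂ) * p.2)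
        (Set.Icc (0 : ℝ) 1 ×ˢ Metric.closedBall z ε) := by fun_prop
    have h1 := hh.continuousOn.comp hc hmaps
    have h2 := hderiv.continuousOn.comp hc hmaps
    simp only [hF']
    exact h1.add (continuousOn_snd.mul
      ((Complex.continuous_ofReal.comp_continuousOn continuousOn_fst).mul h2))
  -- Compactness of [0, 1] times a closed ball in `D0` supplies the constant dominating function.
  obtain ⟨C, hC⟩ := (isCompact_Icc.prod (isCompact_closedBall z ε)).exists_bound_of_continuousOn
    hcontF'
  have hcontF : ∀ x ∈ D0, ContinuousOn (fun t : ℝ => x * h (t * x)) (Set.Icc 0 1) := by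
    intro x hx
    refine continuousOn_const.mul (hh.continuousOn.comp (by fun_prop) fun t ht => hmul t ht x hx)
  have hcontF'z : ContinuousOn (F' z) (Set.Icc 0 1) :=
    hcontF'.comp (f := fun t : ℝ => (t, z)) (by fun_prop)
      fun t ht => ⟨ht, Metric.mem_closedBall_self hε.le⟩
  have hsub : Set.uIoc (0 : ℝ) 1 ⊆ Set.Icc 0 1 := by
    rw [Set.uIoc_of_le zero_le_one]; exact Set.Ioc_subset_Icc_self
  have hmeas : ∀ f : ℝ → ℂ, ContinuousOn f (Set.Icc 0 1) →
      MeasureTheory.AEStronglyMeasurable f (MeasureTheory.volume.restrict (Set.uIoc (0 : ℝ) 1)) :=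
    fun f hf => (hf.mono hsub).aestronglyMeasurable measurableSet_uIoc
  have key := (intervalIntegral.hasDerivAt_integral_of_dominated_loc_of_deriv_le
    (F := fun (x : ℂ) (t : ℝ) => x * h (t * x)) (F' := F') (x₀ := z) (a := 0) (b := 1)
    (μ := MeasureTheory.volume) (bound := fun _ => C) (s := Metric.ball z ε)
    (Metric.ball_mem_nhds z hε) ?_ ?_ (hmeas _ hcontF'z) ?_ (by simp) ?_).2
  · have hFTC : ∫ t in (0 : ℝ)..1, F' z t = h z := by
      have := intervalIntegral.integral_eq_sub_of_hasDerivAt (a := 0) (b := 1)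
        (f := fun t : ℝ => (t : ℂ) * h (t * z)) (f' := F' z) ?_ ?_
      · rw [this]; simp
      · intro t ht
        rw [Set.uIcc_of_le zero_le_one] at ht
        have h1 : HasDerivAt (fun t : ℝ => (t : ℂ)) 1 t := Complex.ofRealCLM.hasDerivAt
        have h2 : HasDerivAt (fun t : ℝ => h (t * z)) (deriv h (t * z) * (1 * z)) t :=
          (hderivAt _ (hmul t ht z hz)).comp t (h1.mul_const z)
        have h3 := h1.mul h2
        refine h3.congr_deriv ?_
        simp only [hF']; ring
      · refine ContinuousOn.intervalIntegrable ?_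
        rwa [Set.uIcc_of_le zero_le_one]
    rwa [hFTC] at key
  · filter_upwards [isOpen_D0.mem_nhds hz] with x hx using hmeas _ (hcontF x hx)
  · refine ContinuousOn.intervalIntegrable ?_
    rw [Set.uIcc_of_le zero_le_one]
    exact hcontF z hz
  · refine Filter.Eventually.of_forall fun t ht x hx => hC (t, x) ⟨hsub ht, ?_⟩
    exact Metric.ball_subset_closedBall hx
  · refine Filter.Eventually.of_forall fun t ht x hx => ?_
    have hx0 : x ∈ D0 := hball (Metric.ball_subset_closedBall hx)
    have h2 : HasDerivAt (fun x : ℂ => h (t * x)) (deriv h (t * x) * (t * 1)) x :=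
      (hderivAt _ (hmul t (hsub ht) x hx0)).comp x ((hasDerivAt_id x).const_mul (t : ℂ))
    have h3 := (hasDerivAt_id x).mul h2
    refine h3.congr_deriv ?_
    simp only [hF', id]; ring

/-! ### Iterated integrals -/

/-- The words in `S⁰`. -/
def IsS0Word (w : Word) : Prop := w = [] ∨ ∃ v : Word, w = v ++ [1]

theorem isS0Word_nil : IsS0Word [] := Or.inl rfl

theorem IsS0Word.tail {a : Fin 2} {w : Word} (h : IsS0Word (a :: w)) : IsS0Word w := by
  rcases h with h | ⟨v, h⟩
  · cases h
  · cases v with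
    | nil => simp at h; exact Or.inl h.2
    | cons b v => simp at h; exact Or.inr ⟨v, h.2⟩

theorem IsS0Word.ne_nil {w : Word} (h : IsS0Word (0 :: w)) : w ≠ [] := by
  rintro rfl
  rcases h with h | ⟨v, h⟩
  · cases h
  · cases v <;> simp at h

theorem word_mem_S0 {w : Word} (hw : IsS0Word w) : word w ∈ S0 :=
  Finsupp.single_mem_supported ℂ _ hw

theorem iterInt_cons_zero (a : Fin 2) (w : Word) : iterInt (a :: w) 0 = 0 := by
  simp [iterInt]

/-- The value of the integrand at t = 0 is irrelevant, so the product with the form may be replaced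
by a holomorphic function h that agrees with it away from 0. -/
theorem iterInt_cons_eq {a : Fin 2} {w : Word} {h : ℂ → ℂ}
    (hh : ∀ z ∈ D0, z ≠ 0 → h z = formCoeff a z * iterInt w z) {z : ℂ} (hz : z ∈ D0) :
    iterInt (a :: w) z = ∫ t in (0 : ℝ)..1, z * h (t * z) := by
  rw [iterInt]
  refine intervalIntegral.integral_congr_ae (Filter.Eventually.of_forall fun t ht => ?_)
  rw [Set.uIoc_of_le zero_le_one] at ht
  by_cases h0 : z = 0
  · simp [h0]
  · have ht0 : (t : ℂ) ≠ 0 := by exact_mod_cast ht.1.ne'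
    rw [hh _ (mul_mem_D0 hz ht.1.le ht.2) (mul_ne_zero ht0 h0)]

/-- For the letter ξ₀ the tail is non-empty, so its integral vanishes at 0 and the pole of dz/z is
removable; `dslope` is the quotient with the singularity filled in. -/
theorem exists_integrand {a : Fin 2} {w : Word} (hw : IsS0Word (a :: w))
    (hd : DifferentiableOn ℂ (iterInt w) D0) :
    ∃ h : ℂ → ℂ, DifferentiableOn ℂ h D0 ∧
      ∀ z ∈ D0, z ≠ 0 → h z = formCoeff a z * iterInt w z := by
  by_cases ha : a = 0
  · subst ha
    refine ⟨dslope (iterInt w) 0,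
      (Complex.differentiableOn_dslope (isOpen_D0.mem_nhds zero_mem_D0)).2 hd, fun z _ h0 => ?_⟩
    obtain ⟨b, v, rfl⟩ := List.exists_cons_of_ne_nil hw.ne_nil
    rw [dslope_of_ne _ h0, slope_def_field, iterInt_cons_zero, formCoeff, if_pos rfl]
    field_simp
    simp
  · refine ⟨fun z => 1 / (1 - z) * iterInt w z, ?_, fun z _ _ => by rw [formCoeff, if_neg ha]⟩
    refine DifferentiableOn.mul (DifferentiableOn.div (by fun_prop) (by fun_prop) ?_) hd
    exact fun z hz => one_sub_ne_zero_of_mem_D0 hz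

theorem differentiableOn_iterInt {w : Word} (hw : IsS0Word w) :
    DifferentiableOn ℂ (iterInt w) D0 := by
  induction w with
  | nil => exact differentiableOn_const (c := (1 : ℂ)) |>.congr fun z _ => by simp [iterInt]
  | cons a w ih =>
    obtain ⟨h, hd, hh⟩ := exists_integrand hw (ih hw.tail)
    refine DifferentiableOn.congr (f := fun z : ℂ => ∫ t in (0 : ℝ)..1, z * h (t * z)) ?_
      fun z hz => iterInt_cons_eq hh hz
    exact fun z hz => (hasDerivAt_segment_primitive hd hz).differentiableAt.differentiableWithinAt

theorem hasDerivAt_iterInt {a : Fin 2} {w : Word} (hw : IsS0Word (a :: w)) {z : ℂ} (hz : z ∈ D0)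
    (h0 : z ≠ 0) : HasDerivAt (iterInt (a :: w)) (formCoeff a z * iterInt w z) z := by
  obtain ⟨h, hd, hh⟩ := exists_integrand hw (differentiableOn_iterInt hw.tail)
  rw [← hh z hz h0]
  refine (hasDerivAt_segment_primitive hd hz).congr_of_eventuallyEq ?_
  filter_upwards [isOpen_D0.mem_nhds hz] with x hx using iterInt_cons_eq hh hx

/-- The origin is excluded from the derivative hypothesis because `formCoeff 0 0` is the default
value 0, not a residue-corrected value. Continuity of the derivative closes the gap. -/
theorem eq_zero_of_hasDerivAt_zero {f : ℂ → ℂ} (hf : DifferentiableOn ℂ f D0)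
    (hf' : ∀ z ∈ D0, z ≠ 0 → HasDerivAt f 0 z) (h0 : f 0 = 0) {z : ℂ} (hz : z ∈ D0) : f z = 0 := by
  have hd : Set.EqOn (deriv f) 0 D0 := by
    intro x hx
    by_cases hx0 : x = 0
    · subst hx0
      have h1 : ContinuousAt (deriv f) 0 :=
        ((hf.deriv isOpen_D0).differentiableAt (isOpen_D0.mem_nhds hx)).continuousAt
      have h2 : Filter.Tendsto (deriv f) (nhdsWithin 0 {0}ᶜ) (nhds 0) := by
        refine tendsto_const_nhds.congr' ?_
        filter_upwards [self_mem_nhdsWithin, mem_nhdsWithin_of_mem_nhds (isOpen_D0.mem_nhds hx)]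
          with y hy hy0 using (hf' y hy0 hy).deriv.symm
      exact tendsto_nhds_unique (h1.tendsto.mono_left nhdsWithin_le_nhds) h2
    · exact (hf' x hx hx0).deriv
  rw [← h0]
  exact isOpen_D0.is_const_of_deriv_eq_zero isPreconnected_D0 hf hd hz zero_mem_D0

/-! ### Multiple polylogarithms on `S⁰` -/

/-- The linear extension of the iterated integrals. -/
noncomputable def liS (z : ℂ) : ShuffleAlg →ₗ[ℂ] ℂ := ofWords fun w => iterInt w z

@[simp] theorem liS_word (z : ℂ) (w : Word) : liS z (word w) = iterInt w z := ofWords_word _ _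

theorem differentiableOn_liS {x : ShuffleAlg} (hx : x ∈ S0) :
    DifferentiableOn ℂ (fun z => liS z x) D0 := by
  refine supported_induction (p := fun x => DifferentiableOn ℂ (fun z => liS z x) D0) hx ?_ ?_ ?_ ?_
  · simp
  · intro x y hx hy; simp only [map_add]; exact hx.add hy
  · intro c x hx; simp only [map_smul]; exact hx.const_smul c
  · intro w hw; simp only [liS_word]; exact differentiableOn_iterInt hw

theorem hasDerivAt_liS {x : ShuffleAlg} (hx : x ∈ S0) {z : ℂ} (hz : z ∈ D0) (h0 : z ≠ 0) :
    HasDerivAt (fun z => liS z x) (∑ a, formCoeff a z * liS z (dL a x)) z := by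
  refine supported_induction
    (p := fun x => HasDerivAt (fun z => liS z x) (∑ a, formCoeff a z * liS z (dL a x)) z)
    hx ?_ ?_ ?_ ?_
  · simpa using hasDerivAt_const z (0 : ℂ)
  · intro x y hx hy
    simp only [map_add, mul_add, Finset.sum_add_distrib]; exact hx.add hy
  · intro c x hx
    simp only [map_smul, smul_eq_mul, mul_left_comm _ c, ← Finset.mul_sum]
    exact hx.const_mul c
  · intro w hw
    cases w with
    | nil => simpa [dL_word_nil, iterInt] using hasDerivAt_const z (1 : ℂ)
    | cons a w =>
      have := hasDerivAt_iterInt hw hz h0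
      simp only [liS_word]
      convert this using 1
      rw [Finset.sum_eq_single a]
      · simp [dL_word_cons]
      · intro b _ hb; simp [dL_word_cons, hb]
      · simp

theorem liS_zero (x : ShuffleAlg) : liS 0 x = x [] := by
  induction x using word_induction with
  | zero => simp
  | add x y hx hy => rw [map_add, hx, hy]; rfl
  | smul a x hx => rw [map_smul, hx]; rfl
  | basis w =>
    cases w with
    | nil => rw [liS_word]; simp [iterInt, word]
    | cons a w => rw [liS_word, iterInt_cons_zero]; simp [word]

/-- By the two induction hypotheses, the recursion for the shuffle is the product rule for the
integrals; both sides vanish at 0. -/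
theorem liS_shuffleWord {z : ℂ} (hz : z ∈ D0) {u v : Word} (hu : IsS0Word u) (hv : IsS0Word v) :
    liS z (shuffleWord u v) = iterInt u z * iterInt v z := by
  induction u, v using word_pair_induction generalizing z with
  | nil_left v => simp [iterInt]
  | nil_right u => simp [iterInt]
  | cons_cons a u b v h1 h2 =>
    have hmem : shuffleWord (a :: u) (b :: v) ∈ S0 := by
      rw [← shuffle_word]; exact shuffle_mem_S0 (word_mem_S0 hu) (word_mem_S0 hv)
    refine sub_eq_zero.1 (eq_zero_of_hasDerivAt_zero
      (f := fun z => liS z (shuffleWord (a :: u) (b :: v)) - iterInt (a :: u) z * iterInt (b :: v) z)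
      ?_ ?_ ?_ hz)
    · exact (differentiableOn_liS hmem).sub
        ((differentiableOn_iterInt hu).mul (differentiableOn_iterInt hv))
    · intro x hx hx0
      have hd := (hasDerivAt_liS hmem hx hx0).sub
        ((hasDerivAt_iterInt hu hx hx0).mul (hasDerivAt_iterInt hv hx hx0))
      refine hd.congr_deriv ?_
      symm
      rw [shuffleWord_cons_cons]
      simp only [map_add, dL_consMap, mul_add, Finset.sum_add_distrib]
      rw [Finset.sum_eq_single a, Finset.sum_eq_single b]
      · rw [if_pos rfl, if_pos rfl, h1 hx hu.tail hv, h2 hx hu hv.tail]; ring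
      · intro c _ hc; simp [hc]
      · simp
      · intro c _ hc; simp [hc]
      · simp
    · rw [shuffleWord_cons_cons]
      simp [liS_zero, iterInt_cons_zero, consMap, Finsupp.mapDomain_of_notMem_range]

theorem liS_shuffle {z : ℂ} (hz : z ∈ D0) {x y : ShuffleAlg} (hx : x ∈ S0) (hy : y ∈ S0) :
    liS z (shuffle x y) = liS z x * liS z y := by
  refine supported_induction (p := fun x => liS z (shuffle x y) = liS z x * liS z y) hx ?_ ?_ ?_ ?_
  · simp
  · intro x₁ x₂ h₁ h₂; rw [shuffle_add_left, map_add, map_add, h₁, h₂, add_mul]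
  · intro c x h; rw [shuffle_smul_left, map_smul, map_smul, h, smul_eq_mul, smul_eq_mul, mul_assoc]
  · intro u hu
    refine supported_induction
      (p := fun y => liS z (shuffle (word u) y) = liS z (word u) * liS z y) hy ?_ ?_ ?_ ?_
    · simp
    · intro x₁ x₂ h₁ h₂; rw [shuffle_add_right, map_add, map_add, h₁, h₂, mul_add]
    · intro c x h
      rw [shuffle_smul_right, map_smul, map_smul, h, smul_eq_mul, smul_eq_mul, mul_left_comm]
    · intro v hv
      rw [shuffle_word, liS_shuffleWord hz hu hv, liS_word, liS_word]

/-! ### Extended multiple polylogarithms -/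

theorem Li_eq (u : ShuffleAlg) (z : ℂ) :
    Li u z = (coeff0 u).sum fun j c => liS z c * (Complex.log z ^ j / (j.factorial : ℂ)) := by
  simp [Li, liS, ofWords, Finsupp.linearCombination_apply]

/-- The extended multiple polylogarithm as a linear form on `S`. -/
noncomputable def liMap (z : ℂ) : ShuffleAlg →ₗ[ℂ] ℂ where
  toFun u := Li u z
  map_add' u v := by
    simp only [Li_eq, coeff0_add]
    rw [Finsupp.sum_add_index' (by simp)]
    intro j c d
    rw [map_add, add_mul]
  map_smul' a u := by
    simp only [Li_eq, coeff0_smul]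
    rw [Finsupp.sum_smul_index' (by simp), Finsupp.sum, RingHom.id_apply, smul_eq_mul, Finsupp.sum,
      Finset.mul_sum]
    refine Finset.sum_congr rfl fun j _ => ?_
    rw [map_smul, smul_eq_mul, mul_assoc]

theorem liMap_apply (z : ℂ) (u : ShuffleAlg) : liMap z u = Li u z := rfl

theorem liMap_shuffle_replicate (z : ℂ) {v : ShuffleAlg} (hv : v ∈ S0) (j : ℕ) :
    liMap z (shuffle v (word (List.replicate j 0))) =
      liS z v * (Complex.log z ^ j / (j.factorial : ℂ)) := by
  rw [liMap_apply, Li_eq, coeff0_shuffle_replicate hv, Finsupp.sum_single_index (by simp)]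

theorem liMap_of_mem_S0 (z : ℂ) {v : ShuffleAlg} (hv : v ∈ S0) : liMap z v = liS z v := by
  simpa using liMap_shuffle_replicate z hv 0

theorem liMap_word_zero (z : ℂ) : liMap z (word [0]) = Complex.log z := by
  have := liMap_shuffle_replicate z word_nil_mem_S0 1
  simpa [iterInt] using this

theorem shuffle_shuffle_shuffle_comm (x y z w : ShuffleAlg) :
    shuffle (shuffle x y) (shuffle z w) = shuffle (shuffle x z) (shuffle y w) := by
  rw [shuffle_assoc, ← shuffle_assoc y, shuffle_comm y z, shuffle_assoc z, ← shuffle_assoc x]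

/-- On S⁰[ξ₀] it remains to compare powers of ξ₀, where the binomial coefficient in
`shuffleWord_replicate` cancels against the factorials in log^j z / j!. -/
theorem isShuffleHom_liMap {z : ℂ} (hz : z ∈ D0) : IsShuffleHom (liMap z) := by
  refine ⟨by simp [liMap_of_mem_S0 z word_nil_mem_S0, iterInt], fun x y => ?_⟩
  induction x using poly0_induction with
  | zero => simp
  | add x₁ x₂ h₁ h₂ => rw [shuffle_add_left, map_add, map_add, h₁, h₂, add_mul]
  | basis v hv i =>
    induction y using poly0_induction with
    | zero => simp
    | add x₁ x₂ h₁ h₂ => rw [shuffle_add_right, map_add, map_add, h₁, h₂, mul_add]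
    | basis w hw j =>
      rw [shuffle_shuffle_shuffle_comm, shuffle_word, shuffleWord_replicate, shuffle_smul_right,
        map_smul, liMap_shuffle_replicate z (shuffle_mem_S0 hv hw), liMap_shuffle_replicate z hv,
        liMap_shuffle_replicate z hw, liS_shuffle hz hv hw, smul_eq_mul,
        Nat.cast_add_choose ℂ]
      have h1 : (i.factorial : ℂ) ≠ 0 := by exact_mod_cast i.factorial_ne_zero
      have h2 : (j.factorial : ℂ) ≠ 0 := by exact_mod_cast j.factorial_ne_zero
      have h3 : ((i + j).factorial : ℂ) ≠ 0 := by exact_mod_cast (i + j).factorial_ne_zero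
      field_simp
      ring

/-- The Leibniz rule for `dL` matches the product rule: `dL 0` lowers the power of ξ₀ exactly as
d/dz acts on log^j z / j!, up to the factor 1/z, and `dL 1` kills powers of ξ₀. -/
theorem hasDerivAt_liMap (u : ShuffleAlg) {z : ℂ} (hz : z ∈ D0 ∩ D1) :
    HasDerivAt (fun z => liMap z u) (∑ a, formCoeff a z * liMap z (dL a u)) z := by
  induction u using poly0_induction with
  | zero => simpa using hasDerivAt_const z (0 : ℂ)
  | add x y hx hy =>
    simp only [map_add, mul_add, Finset.sum_add_distrib]; exact hx.add hy
  | basis v hv j =>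
    have hz0 := ne_zero_of_mem_D1 hz.2
    have hlog := Complex.hasDerivAt_log (mem_D1_iff.1 hz.2)
    simp only [liMap_shuffle_replicate _ hv, dL_shuffle, map_add,
      liMap_shuffle_replicate _ (dL_mem_S0 _ hv)]
    have h := (hasDerivAt_liS hv hz.1 hz0).mul ((hlog.pow j).div_const (j.factorial : ℂ))
    refine h.congr_deriv ?_
    symm
    simp only [mul_add, Finset.sum_add_distrib, Finset.sum_mul, Pi.pow_apply]
    congr 1
    · exact Finset.sum_congr rfl fun a _ => by ring
    · rw [Fin.sum_univ_two, dL_replicate_of_ne one_ne_zero, shuffle_zero_right, map_zero, mul_zero,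
        add_zero]
      cases j with
      | zero => simp [dL_word_nil]
      | succ j =>
        rw [dL_replicate_succ, liMap_shuffle_replicate _ hv, formCoeff, if_pos rfl,
          Nat.factorial_succ]
        have h1 : (j.factorial : ℂ) ≠ 0 := by exact_mod_cast j.factorial_ne_zero
        have h2 : ((j : ℂ) + 1) ≠ 0 := by exact_mod_cast j.succ_ne_zero
        push_cast
        field_simp

/-! ### Growth at infinity -/

theorem norm_formCoeff_le {z : ℂ} (hz : 2 ≤ ‖z‖) (a : Fin 2) : ‖formCoeff a z‖ ≤ 2 / ‖z‖ := by
  have hpos : 0 < ‖z‖ := by linarith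
  rw [formCoeff]
  split_ifs
  · rw [norm_div, norm_one]; gcongr; norm_num
  · rw [norm_div, norm_one]
    have h1 : ‖z‖ - 1 ≤ ‖1 - z‖ := by
      have := norm_sub_norm_le z 1
      rwa [norm_one, norm_sub_rev] at this
    have h2 : ‖z‖ / 2 ≤ ‖1 - z‖ := by linarith
    calc 1 / ‖1 - z‖ ≤ 1 / (‖z‖ / 2) := by gcongr
      _ = 2 / ‖z‖ := by field_simp

theorem mem_D0_of_neg_mem_slitPlane {z : ℂ} (hz : -z ∈ Complex.slitPlane) : z ∈ D0 := by
  rintro ⟨h1, h2⟩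
  rw [Complex.mem_slitPlane_iff] at hz
  rcases hz with h | h
  · rw [Complex.neg_re] at h; linarith
  · rw [Complex.neg_im] at h; simp [h1] at h

theorem exp_mem_slitPlane_of_im {w : ℂ} (h1 : -Real.pi < w.im) (h2 : w.im < Real.pi) :
    Complex.exp w ∈ Complex.slitPlane := by
  rw [Complex.mem_slitPlane_iff_arg]
  refine ⟨?_, Complex.exp_ne_zero _⟩
  rw [← Complex.log_im, Complex.log_exp h1 h2.le]
  exact h2.ne

theorem neg_mem_slitPlane_of_mem_D0 {z : ℂ} (hz : z ∈ D0) (h : 2 ≤ ‖z‖) :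
    -z ∈ Complex.slitPlane := by
  rw [Complex.mem_slitPlane_iff]
  by_contra! hcon
  obtain ⟨h1, h2⟩ := hcon
  rw [Complex.neg_re] at h1
  have him : z.im = 0 := by simpa using h2
  refine hz ⟨him, ?_⟩
  have : ‖z‖ = |z.re| := by
    rw [← Complex.re_add_im z, him]; simp
  rw [this, abs_of_nonneg (by linarith)] at h
  linarith

/-- A function on `D₀` whose derivative is `O(|z|^(-1/2))` at infinity is `O(|z|^(1/2))`. -/
theorem norm_le_sqrt_of_norm_deriv_le {f f' : ℂ → ℂ} {C : ℝ}
    (hf : ∀ z ∈ D0, 2 ≤ ‖z‖ → HasDerivAt f (f' z) z)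
    (hf' : ∀ z ∈ D0, 2 ≤ ‖z‖ → ‖f' z‖ ≤ C / √‖z‖) {z : ℂ} (hz : z ∈ D0) (h2 : 2 ≤ ‖z‖) :
    ‖f z‖ ≤ (‖f (-2)‖ + 2 * C + Real.pi * C) * √‖z‖ := by
  set r := ‖z‖ with hr
  have hrpos : 0 < r := by linarith
  have hs1 : 1 ≤ √r := Real.one_le_sqrt.2 (by linarith)
  have hnegmem : ∀ x : ℝ, 2 ≤ x → (-x : ℂ) ∈ D0 := fun x hx =>
    mem_D0_of_neg_mem_slitPlane (by rw [neg_neg, Complex.ofReal_mem_slitPlane]; linarith)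
  have hnegnorm : ∀ x : ℝ, 2 ≤ x → ‖(-x : ℂ)‖ = x := fun x hx => by
    rw [norm_neg, Complex.norm_real, Real.norm_of_nonneg (by linarith)]
  have hC : 0 ≤ C := by
    have h := (norm_nonneg _).trans (hf' z hz h2)
    by_contra! hneg
    have : C / √r < 0 := div_neg_of_neg_of_pos hneg (by linarith)
    linarith
  -- Travel from -2 to -r along the negative axis; 2C√x has derivative C/√x.
  have step1 : ‖f (-r)‖ ≤ ‖f (-2)‖ + 2 * C * √r := by
    have hd : ∀ x : ℝ, 2 ≤ x → HasDerivAt (fun x : ℝ => f (-x)) (f' (-x) * -1) x := by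
      intro x hx
      have h1 : HasDerivAt (fun t : ℝ => (-t : ℂ)) (-1) x := Complex.ofRealCLM.hasDerivAt.neg
      exact (hf _ (hnegmem x hx) (by rw [hnegnorm x hx]; exact hx)).comp x h1
    refine image_norm_le_of_norm_deriv_right_le_deriv_boundary' (a := 2) (b := r)
      (f := fun x : ℝ => f (-x)) (f' := fun x : ℝ => f' (-x) * -1)
      (B := fun x => ‖f (-2)‖ + 2 * C * √x) (B' := fun x => 2 * C * (1 / (2 * √x)))
      (fun x hx => (hd x hx.1).continuousAt.continuousWithinAt)
      (fun x hx => (hd x hx.1).hasDerivWithinAt) ?_ (by fun_prop) ?_ ?_ ⟨h2, le_rfl⟩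
    · simp only [Complex.ofReal_ofNat]
      have : 0 ≤ 2 * C * √2 := by positivity
      linarith
    · intro x hx
      have hx0 : x ≠ 0 := by linarith [hx.1]
      exact (((Real.hasDerivAt_sqrt hx0).const_mul (2 * C)).const_add _).hasDerivWithinAt
    · intro x hx
      have h := hf' _ (hnegmem x hx.1) (by rw [hnegnorm x hx.1]; exact hx.1)
      rw [hnegnorm x hx.1] at h
      rw [norm_mul, norm_neg, norm_one, mul_one]
      refine h.trans (le_of_eq ?_)
      have : 0 < √x := Real.sqrt_pos.2 (by linarith [hx.1])
      field_simp
  -- Then follow the arc of radius r from -r to z, which avoids the positive axis and has length at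
  -- most πr.
  have step2 : ‖f z - f (-r)‖ ≤ Real.pi * C * √r := by
    have hslit := neg_mem_slitPlane_of_mem_D0 hz h2
    have hz0 : -z ≠ 0 := Complex.slitPlane_ne_zero hslit
    set φ := Complex.arg (-z) with hφ
    have hφ1 : |φ| < Real.pi := by
      have h1 := Complex.neg_pi_lt_arg (-z)
      have h3 := lt_of_le_of_ne (Complex.arg_le_pi (-z)) (Complex.mem_slitPlane_iff_arg.1 hslit).1
      exact abs_lt.2 ⟨h1, h3⟩
    set γ : ℝ → ℂ := fun t => -Complex.exp ((Real.log r : ℂ) + t * (φ * Complex.I)) with hγ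
    have hγnorm : ∀ t, ‖γ t‖ = r := by
      intro t
      simp only [hγ]
      rw [norm_neg, Complex.norm_exp]
      simp [Real.exp_log hrpos]
    have hγD : ∀ t ∈ Set.Icc (0 : ℝ) 1, γ t ∈ D0 := by
      intro t ht
      refine mem_D0_of_neg_mem_slitPlane ?_
      simp only [hγ, neg_neg]
      have him : ((Real.log r : ℂ) + t * (φ * Complex.I)).im = t * φ := by simp
      have habs : |t * φ| < Real.pi := by
        rw [abs_mul, abs_of_nonneg ht.1]
        nlinarith [abs_nonneg φ, ht.2]
      rw [abs_lt] at habs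
      exact exp_mem_slitPlane_of_im (by rw [him]; exact habs.1) (by rw [him]; exact habs.2)
    have hγ1 : γ 1 = z := by
      simp only [hγ]
      have : (Real.log r : ℂ) + (1 : ℝ) * (φ * Complex.I) = Complex.log (-z) := by
        rw [Complex.log, norm_neg]; simp [hr, hφ]
      rw [this, Complex.exp_log hz0, neg_neg]
    have hγ0 : γ 0 = -r := by
      simp only [hγ]
      rw [Complex.ofReal_zero, zero_mul, add_zero, ← Complex.ofReal_exp, Real.exp_log hrpos]
    have hγd : ∀ t, HasDerivAt γ (γ t * (φ * Complex.I)) t := by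
      intro t
      have h1 : HasDerivAt (fun t : ℝ => (Real.log r : ℂ) + t * (φ * Complex.I))
          (1 * (φ * Complex.I)) t :=
        ((Complex.ofRealCLM.hasDerivAt (x := t)).mul_const _).const_add _
      refine h1.cexp.neg.congr_deriv ?_
      simp only [hγ]; ring
    have hcomp : ∀ t ∈ Set.Icc (0 : ℝ) 1,
        HasDerivAt (fun t => f (γ t)) (f' (γ t) * (γ t * (φ * Complex.I))) t := fun t ht =>
      (hf _ (hγD t ht) (by rw [hγnorm]; exact h2)).comp t (hγd t)
    have hseg := norm_image_sub_le_of_norm_deriv_le_segment_01' (C := Real.pi * C * √r)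
      (fun t ht => (hcomp t ht).hasDerivWithinAt) ?_
    · rwa [hγ1, hγ0] at hseg
    · intro t ht
      have ht' : t ∈ Set.Icc (0 : ℝ) 1 := ⟨ht.1, ht.2.le⟩
      have h := hf' _ (hγD t ht') (by rw [hγnorm]; exact h2)
      rw [hγnorm] at h
      rw [norm_mul, norm_mul, hγnorm, norm_mul, Complex.norm_I, mul_one, Complex.norm_real,
        Real.norm_eq_abs]
      calc ‖f' (γ t)‖ * (r * |φ|) ≤ (C / √r) * (r * Real.pi) := by gcongr
        _ = Real.pi * C * (r / √r) := by ring
        _ = Real.pi * C * √r := by rw [Real.div_sqrt]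
  calc ‖f z‖ = ‖(f z - f (-r)) + f (-r)‖ := by rw [sub_add_cancel]
    _ ≤ ‖f z - f (-r)‖ + ‖f (-r)‖ := norm_add_le _ _
    _ ≤ Real.pi * C * √r + (‖f (-2)‖ * √r + 2 * C * √r) := by
        have : ‖f (-2)‖ ≤ ‖f (-2)‖ * √r := le_mul_of_one_le_right (norm_nonneg _) hs1
        linarith
    _ = _ := by ring

theorem two_le_norm_ne_zero {z : ℂ} (h2 : 2 ≤ ‖z‖) : z ≠ 0 :=
  norm_pos_iff.1 (by linarith)

/-- The true growth is a power of a logarithm. The bound √|z| is weaker but reproduces itself: 1/|z|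
times √|z| integrates to a multiple of √|z|, so one exponent serves for all words. -/
theorem exists_norm_iterInt_le {w : Word} (hw : IsS0Word w) :
    ∃ C, 0 ≤ C ∧ ∀ z ∈ D0, 2 ≤ ‖z‖ → ‖iterInt w z‖ ≤ C * √‖z‖ := by
  induction w with
  | nil =>
    refine ⟨1, zero_le_one, fun z _ h2 => ?_⟩
    rw [iterInt, norm_one, one_mul]
    exact Real.one_le_sqrt.2 (by linarith)
  | cons a w ih =>
    obtain ⟨C, hC, h⟩ := ih hw.tail
    refine ⟨‖iterInt (a :: w) (-2)‖ + 2 * (2 * C) + Real.pi * (2 * C),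
      by have := Real.pi_pos; positivity, fun z hz h2 => ?_⟩
    refine norm_le_sqrt_of_norm_deriv_le
      (fun z hz h2 => hasDerivAt_iterInt hw hz (two_le_norm_ne_zero h2)) (fun z hz h2 => ?_) hz h2
    rw [norm_mul]
    have hs : 0 < √‖z‖ := Real.sqrt_pos.2 (by linarith)
    calc ‖formCoeff a z‖ * ‖iterInt w z‖ ≤ 2 / ‖z‖ * (C * √‖z‖) := by
          gcongr
          exacts [norm_formCoeff_le h2 a, h z hz h2]
      _ = 2 * C * (√‖z‖ / ‖z‖) := by ring
      _ = 2 * C / √‖z‖ := by rw [Real.sqrt_div_self]; ring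

theorem exists_norm_liS_le {x : ShuffleAlg} (hx : x ∈ S0) :
    ∃ C, ∀ z ∈ D0, 2 ≤ ‖z‖ → ‖liS z x‖ ≤ C * √‖z‖ := by
  refine supported_induction
    (p := fun x => ∃ C, ∀ z ∈ D0, 2 ≤ ‖z‖ → ‖liS z x‖ ≤ C * √‖z‖) hx ?_ ?_ ?_ ?_
  · exact ⟨0, by simp⟩
  · rintro x y ⟨C, hC⟩ ⟨D, hD⟩
    refine ⟨C + D, fun z hz h2 => ?_⟩
    rw [map_add, add_mul]
    exact (norm_add_le _ _).trans (add_le_add (hC z hz h2) (hD z hz h2))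
  · rintro c x ⟨C, hC⟩
    refine ⟨‖c‖ * C, fun z hz h2 => ?_⟩
    rw [map_smul, norm_smul, mul_assoc]
    exact mul_le_mul_of_nonneg_left (hC z hz h2) (norm_nonneg _)
  · intro w hw
    obtain ⟨C, _, hC⟩ := exists_norm_iterInt_le hw
    exact ⟨C, by simpa using hC⟩

theorem tendsto_deriv_liS {x : ShuffleAlg} (hx : x ∈ S0) :
    Filter.Tendsto (deriv fun z => liS z x) (Bornology.cobounded ℂ ⊓ Filter.principal D0)
      (nhds 0) := by
  choose C hC using fun a => exists_norm_liS_le (dL_mem_S0 a hx)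
  have hlim : Filter.Tendsto (fun z : ℂ => (∑ a, 2 * C a) / √‖z‖)
      (Bornology.cobounded ℂ ⊓ Filter.principal D0) (nhds 0) :=
    ((Real.tendsto_sqrt_atTop.comp tendsto_norm_cobounded_atTop).const_div_atTop _).mono_left
      inf_le_left
  refine squeeze_zero_norm' ?_ hlim
  have h2 : ∀ᶠ z : ℂ in Bornology.cobounded ℂ, 2 ≤ ‖z‖ :=
    tendsto_norm_cobounded_atTop.eventually_ge_atTop 2
  filter_upwards [Filter.mem_inf_of_left h2,
    Filter.mem_inf_of_right (Filter.mem_principal_self D0)] with z h2 hz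
  rw [(hasDerivAt_liS hx hz (two_le_norm_ne_zero h2)).deriv, Finset.sum_div]
  refine norm_sum_le_of_le _ fun a _ => ?_
  rw [norm_mul]
  calc ‖formCoeff a z‖ * ‖liS z (dL a x)‖ ≤ 2 / ‖z‖ * (C a * √‖z‖) := by
        gcongr
        exacts [norm_formCoeff_le h2 a, hC a z hz h2]
    _ = 2 * C a * (√‖z‖ / ‖z‖) := by ring
    _ = 2 * C a / √‖z‖ := by rw [Real.sqrt_div_self]; ring

/-! ### Growth at one -/

theorem ofReal_mem_D0 {x : ℝ} (hx : x < 1) : (x : ℂ) ∈ D0 := by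
  rintro ⟨_, h⟩
  rw [Complex.ofReal_re] at h
  linarith

theorem ofReal_mem_inter {x : ℝ} (h0 : 0 < x) (h1 : x < 1) : (x : ℂ) ∈ D0 ∩ D1 :=
  ⟨ofReal_mem_D0 h1, mem_D1_iff.2 (Complex.ofReal_mem_slitPlane.2 h0)⟩

theorem norm_formCoeff_ofReal_le {x : ℝ} (h0 : 1 / 2 ≤ x) (h1 : x < 1) (a : Fin 2) :
    ‖formCoeff a x‖ ≤ 1 / (1 - x) := by
  rw [formCoeff]
  split_ifs
  · rw [norm_div, norm_one, Complex.norm_real, Real.norm_of_nonneg (by linarith)]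
    exact one_div_le_one_div_of_le (by linarith) (by linarith)
  · rw [← Complex.ofReal_one, ← Complex.ofReal_sub, norm_div, Complex.norm_real, Complex.norm_real,
      Real.norm_of_nonneg (by linarith : 0 ≤ 1 - x), norm_one]

/-- The analogue at 1 of the bound at infinity: C(1 - x)^(-3/2) has the primitive 2C(1 - x)^(-1/2),
so the exponent is stable under integration from 1/2. -/
theorem exists_norm_iterInt_ofReal_le {w : Word} (hw : IsS0Word w) :
    ∃ C, 0 ≤ C ∧ ∀ x : ℝ, 1 / 2 ≤ x → x < 1 → ‖iterInt w x‖ ≤ C / √(1 - x) := by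
  have hone : ∀ x : ℝ, 1 / 2 ≤ x → x < 1 → 1 ≤ 1 / √(1 - x) := fun x h0 h1 => by
    rw [le_div_iff₀ (Real.sqrt_pos.2 (by linarith)), one_mul, Real.sqrt_le_iff]
    constructor <;> linarith
  induction w with
  | nil => exact ⟨1, zero_le_one, fun x h0 h1 => by rw [iterInt, norm_one]; exact hone x h0 h1⟩
  | cons a w ih =>
    obtain ⟨C, hC, h⟩ := ih hw.tail
    set M := ‖iterInt (a :: w) ((1 / 2 : ℝ) : ℂ)‖ with hM
    refine ⟨M + 2 * C, by positivity, fun b hb0 hb1 => ?_⟩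
    have hd : ∀ x : ℝ, 1 / 2 ≤ x → x < 1 → HasDerivAt (fun x : ℝ => iterInt (a :: w) x)
        (formCoeff a x * iterInt w x) x := by
      intro x h0 h1
      have hx0 : (x : ℂ) ≠ 0 := by
        have : x ≠ 0 := by linarith
        exact_mod_cast this
      exact (hasDerivAt_iterInt hw (ofReal_mem_D0 h1) hx0).comp_ofReal
    have hB : ∀ x : ℝ, x < 1 → HasDerivAt (fun x => M + 2 * C * (√(1 - x))⁻¹)
        (2 * C * (-(-1 / (2 * √(1 - x))) / √(1 - x) ^ 2)) x := by
      intro x h1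
      have hx : 1 - x ≠ 0 := by linarith
      have h2 := (((hasDerivAt_id x).const_sub 1).sqrt hx).fun_inv
        (Real.sqrt_ne_zero'.2 (by simp only [id]; linarith))
      exact (h2.const_mul (2 * C)).const_add M
    have key := image_norm_le_of_norm_deriv_right_le_deriv_boundary' (a := 1 / 2) (b := b)
      (f := fun x : ℝ => iterInt (a :: w) x) (f' := fun x : ℝ => formCoeff a x * iterInt w x)
      (B := fun x => M + 2 * C * (√(1 - x))⁻¹)
      (B' := fun x => 2 * C * (-(-1 / (2 * √(1 - x))) / √(1 - x) ^ 2))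
      (fun x hx => (hd x hx.1 (hx.2.trans_lt hb1)).continuousAt.continuousWithinAt)
      (fun x hx => (hd x hx.1 (hx.2.trans hb1)).hasDerivWithinAt) ?_
      (fun x hx => (hB x (hx.2.trans_lt hb1)).continuousAt.continuousWithinAt)
      (fun x hx => (hB x (hx.2.trans hb1)).hasDerivWithinAt) ?_ ⟨hb0, le_rfl⟩
    · refine key.trans ?_
      have := mul_le_mul_of_nonneg_left (hone b hb0 hb1) (norm_nonneg _ : 0 ≤ M)
      rw [mul_one] at this
      calc M + 2 * C * (√(1 - b))⁻¹ ≤ M * (1 / √(1 - b)) + 2 * C * (√(1 - b))⁻¹ := by linarith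
        _ = (M + 2 * C) / √(1 - b) := by ring
    · have : 0 ≤ 2 * C * (√(1 - 1 / 2))⁻¹ := by positivity
      simp only [hM]; linarith
    · intro x hx
      have hx1 : 0 < 1 - x := by linarith [hx.2]
      have hs : 0 < √(1 - x) := Real.sqrt_pos.2 hx1
      rw [norm_mul]
      calc ‖formCoeff a x‖ * ‖iterInt w x‖ ≤ 1 / (1 - x) * (C / √(1 - x)) := by
            gcongr
            exacts [norm_formCoeff_ofReal_le hx.1 (by linarith) a, h x hx.1 (by linarith)]
        _ = _ := by
          rw [Real.sq_sqrt hx1.le]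
          field_simp

/-! ### Power series -/

/-- The Taylor coefficients at `0` of the iterated integral of a word. -/
noncomputable def liCoeff : Word → ℕ → ℂ
  | [], n => if n = 0 then 1 else 0
  | a :: w, n => (if a = 0 then liCoeff w n else ∑ m ∈ Finset.range n, liCoeff w m) / n

theorem liCoeff_cons_zero (a : Fin 2) (w : Word) : liCoeff (a :: w) 0 = 0 := by
  simp [liCoeff]

theorem liCoeff_zero {w : Word} (hw : w ≠ []) : liCoeff w 0 = 0 := by
  obtain ⟨a, v, rfl⟩ := List.exists_cons_of_ne_nil hw
  exact liCoeff_cons_zero a v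

theorem norm_liCoeff_le (w : Word) (n : ℕ) : ‖liCoeff w n‖ ≤ 1 := by
  induction w generalizing n with
  | nil => rw [liCoeff]; split_ifs <;> simp
  | cons a w ih =>
    rcases Nat.eq_zero_or_pos n with rfl | hn
    · simp [liCoeff_cons_zero]
    have hn' : (1 : ℝ) ≤ n := by exact_mod_cast hn
    rw [liCoeff, norm_div, Complex.norm_natCast, div_le_one (by linarith)]
    split_ifs
    · exact (ih n).trans hn'
    · refine (norm_sum_le_of_le _ fun m _ => ih m).trans ?_
      simp

/-- The coefficients of the integrand of `iterInt (a :: w)`. -/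
noncomputable def integrandCoeff (a : Fin 2) (w : Word) (n : ℕ) : ℂ :=
  if a = 0 then liCoeff w (n + 1) else ∑ m ∈ Finset.range (n + 1), liCoeff w m

theorem liCoeff_cons_succ (a : Fin 2) (w : Word) (n : ℕ) :
    liCoeff (a :: w) (n + 1) = integrandCoeff a w n / (n + 1) := by
  rw [liCoeff, integrandCoeff]; push_cast; rfl

theorem norm_integrandCoeff_le (a : Fin 2) (w : Word) (n : ℕ) :
    ‖integrandCoeff a w n‖ ≤ n + 1 := by
  rw [integrandCoeff]
  split_ifs
  · exact (norm_liCoeff_le _ _).trans (by simp)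
  · refine (norm_sum_le_of_le _ fun m _ => norm_liCoeff_le w m).trans ?_
    simp

theorem summable_norm_liCoeff_mul_pow (w : Word) {y : ℂ} (hy : ‖y‖ < 1) :
    Summable fun n => ‖liCoeff w n * y ^ n‖ := by
  refine Summable.of_nonneg_of_le (fun _ => norm_nonneg _) (fun n => ?_)
    (summable_geometric_of_lt_one (norm_nonneg y) hy)
  rw [norm_mul, norm_pow]
  exact mul_le_of_le_one_left (by positivity) (norm_liCoeff_le w n)

/-- Division by y shifts the coefficients, and multiplication by 1/(1 - y) replaces them by their
partial sums, as a Cauchy product with the geometric series. -/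
theorem hasSum_integrand {a : Fin 2} {w : Word} (hw : IsS0Word (a :: w)) {y : ℂ} (hy : ‖y‖ < 1)
    (h0 : y ≠ 0) (h : HasSum (fun n => liCoeff w n * y ^ n) (iterInt w y)) :
    HasSum (fun n => integrandCoeff a w n * y ^ n) (formCoeff a y * iterInt w y) := by
  by_cases ha : a = 0
  · subst ha
    have h1 := (hasSum_nat_add_iff' 1).2 h
    rw [Finset.sum_range_one, liCoeff_zero hw.ne_nil, zero_mul, sub_zero] at h1
    have h2 := h1.mul_left (1 / y)
    rw [formCoeff, if_pos rfl]
    refine h2.congr_fun fun n => ?_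
    rw [integrandCoeff, if_pos rfl, pow_succ]
    field_simp
  · have hg : Summable fun n : ℕ => ‖y ^ n‖ := by
      simpa only [norm_pow] using summable_geometric_of_lt_one (norm_nonneg y) hy
    have h1 := hasSum_sum_range_mul_of_summable_norm (summable_norm_liCoeff_mul_pow w hy) hg
    rw [h.tsum_eq, tsum_geometric_of_norm_lt_one hy, mul_comm] at h1
    rw [formCoeff, if_neg ha, one_div]
    refine h1.congr_fun fun n => ?_
    rw [integrandCoeff, if_neg ha, Finset.sum_mul]
    refine Finset.sum_congr rfl fun k hk => ?_
    have hk' : k + (n - k) = n := by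
      have := Finset.mem_range.1 hk
      omega
    rw [mul_assoc, ← pow_add, hk']

theorem hasSum_iterInt {w : Word} (hw : IsS0Word w) {z : ℂ} (hz : ‖z‖ < 1) :
    HasSum (fun n => liCoeff w n * z ^ n) (iterInt w z) := by
  induction w generalizing z with
  | nil =>
    rw [iterInt]
    convert hasSum_single (f := fun n => liCoeff [] n * z ^ n) 0 ?_ using 1
    · simp [liCoeff]
    · intro n hn; simp [liCoeff, hn]
  | cons a w ih =>
    by_cases hz0 : z = 0
    · subst hz0
      rw [iterInt_cons_zero]
      convert hasSum_zero (α := ℂ) (β := ℕ) using 2 with n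
      cases n with
      | zero => rw [liCoeff_cons_zero, zero_mul]
      | succ n => rw [zero_pow n.succ_ne_zero, mul_zero]
    · have hint : HasSum (fun n => ∫ t in (0 : ℝ)..1, integrandCoeff a w n * z ^ (n + 1) * (t : ℂ) ^ n)
          (iterInt (a :: w) z) := by
        rw [iterInt]
        -- The crude bound n + 1 on the integrand coefficients suffices for dominated convergence,
        -- since |z| < 1.
        have hsum : Summable fun n : ℕ => ((n : ℝ) + 1) * ‖z‖ ^ (n + 1) := by
          have h1 := (summable_nat_add_iff 1).2
            (summable_pow_mul_geometric_of_norm_lt_one 1 (r := ‖z‖) (by rwa [norm_norm]))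
          simpa using h1
        refine intervalIntegral.hasSum_integral_of_dominated_convergence
          (fun n _ => ((n : ℝ) + 1) * ‖z‖ ^ (n + 1)) (fun n => ?_) (fun n => ?_) ?_ ?_ ?_
        · exact Continuous.aestronglyMeasurable (by fun_prop)
        · refine Filter.Eventually.of_forall fun t ht => ?_
          rw [Set.uIoc_of_le zero_le_one] at ht
          rw [norm_mul, norm_mul, norm_pow, norm_pow, Complex.norm_real, Real.norm_of_nonneg ht.1.le]
          have h1 : t ^ n ≤ 1 := pow_le_one₀ ht.1.le ht.2
          calc ‖integrandCoeff a w n‖ * ‖z‖ ^ (n + 1) * t ^ n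
              ≤ ((n : ℝ) + 1) * ‖z‖ ^ (n + 1) * 1 := by
                gcongr
                · have := ht.1.le
                  positivity
                · exact norm_integrandCoeff_le a w n
            _ = _ := mul_one _
        · exact Filter.Eventually.of_forall fun t _ => hsum
        · exact intervalIntegrable_const
        · refine Filter.Eventually.of_forall fun t ht => ?_
          rw [Set.uIoc_of_le zero_le_one] at ht
          have ht0 : (t : ℂ) ≠ 0 := by exact_mod_cast ht.1.ne'
          have hy : ‖(t : ℂ) * z‖ < 1 := by
            rw [norm_mul, Complex.norm_real, Real.norm_of_nonneg ht.1.le]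
            nlinarith [norm_nonneg z, ht.2]
          have := (hasSum_integrand hw hy (mul_ne_zero ht0 hz0) (ih hw.tail hy)).mul_left z
          refine this.congr_fun fun n => ?_
          rw [mul_pow]; ring
      have hshift : HasSum (fun n => liCoeff (a :: w) (n + 1) * z ^ (n + 1)) (iterInt (a :: w) z) := by
        refine hint.congr_fun fun n => ?_
        rw [intervalIntegral.integral_const_mul]
        have : ∫ t in (0 : ℝ)..1, (t : ℂ) ^ n = 1 / ((n : ℂ) + 1) := by
          have h1 : ∫ t in (0 : ℝ)..1, ((t ^ n : ℝ) : ℂ) = ((∫ t in (0 : ℝ)..1, t ^ n : ℝ) : ℂ) :=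
            intervalIntegral.integral_ofReal
          rw [integral_pow] at h1
          simpa using h1
        rw [this, liCoeff_cons_succ]
        ring
      have := (hasSum_nat_add_iff (f := fun n => liCoeff (a :: w) n * z ^ n) 1).1 hshift
      simpa [liCoeff_cons_zero] using this

/-! ### Convergence of the multiple zeta series -/

theorem sum_one_div_sqrt_le (n : ℕ) :
    ∑ m ∈ Finset.range (n + 1), 1 / √(m : ℝ) ≤ 2 * √(n : ℝ) := by
  induction n with
  | zero => simp
  | succ n ih =>
    rw [Finset.sum_range_succ]
    have ht : 0 < √((n + 1 : ℕ) : ℝ) := Real.sqrt_pos.2 (by positivity)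
    have hs := Real.sqrt_nonneg (n : ℝ)
    have h1 : √((n + 1 : ℕ) : ℝ) ^ 2 = n + 1 := by rw [Real.sq_sqrt (by positivity)]; push_cast; rfl
    have h2 : √(n : ℝ) ^ 2 = n := Real.sq_sqrt (by positivity)
    have h3 : 2 * √(n : ℝ) + 1 / √((n + 1 : ℕ) : ℝ) ≤ 2 * √((n + 1 : ℕ) : ℝ) := by
      rw [← le_sub_iff_add_le', div_le_iff₀ ht]
      -- With s = √n and t = √(n+1), the claim reads 2st + 1 ≤ 2t², which is (t - s)² ≥ 0 because t²
      -- - s² = 1.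
      nlinarith [sq_nonneg (√((n + 1 : ℕ) : ℝ) - √(n : ℝ))]
    linarith

/-- The two bounds feed each other: partial sums O(√n), divided by n, give coefficients O(1/√n), and
summing these gives O(√n) again. -/
theorem exists_norm_sum_liCoeff_le (w : Word) :
    ∃ C, 0 ≤ C ∧ (∀ n, ‖∑ m ∈ Finset.range n, liCoeff w m‖ ≤ C * √(n : ℝ)) ∧
      ∀ n, 1 ≤ n → ‖liCoeff w n‖ ≤ C / √(n : ℝ) := by
  induction w with
  | nil =>
    refine ⟨1, zero_le_one, fun n => ?_, fun n hn => ?_⟩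
    · simp only [liCoeff]
      rw [Finset.sum_ite_eq']
      split_ifs with h
      · rw [norm_one, one_mul]
        have : 1 ≤ n := Finset.mem_range.1 h
        exact Real.one_le_sqrt.2 (by exact_mod_cast this)
      · simp
    · rw [liCoeff, if_neg (by omega), norm_zero]; positivity
  | cons a w ih =>
    obtain ⟨C, hC, h1, h2⟩ := ih
    have hterm : ∀ n, ‖liCoeff (a :: w) n‖ ≤ C * (1 / √(n : ℝ)) := by
      intro n
      rcases Nat.eq_zero_or_pos n with rfl | hn
      · simp [liCoeff_cons_zero]
      have hn' : (1 : ℝ) ≤ n := by exact_mod_cast hn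
      have hs : 1 ≤ √(n : ℝ) := Real.one_le_sqrt.2 hn'
      rw [liCoeff, norm_div, Complex.norm_natCast]
      split_ifs
      · calc ‖liCoeff w n‖ / n ≤ ‖liCoeff w n‖ / 1 := by gcongr
          _ ≤ C * (1 / √(n : ℝ)) := by rw [div_one, mul_one_div]; exact h2 n hn
      · calc ‖∑ m ∈ Finset.range n, liCoeff w m‖ / n ≤ C * √(n : ℝ) / n := by gcongr; exact h1 n
          _ = C * (√(n : ℝ) / n) := by ring
          _ = C * (1 / √(n : ℝ)) := by rw [Real.sqrt_div_self, one_div]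
    refine ⟨2 * C, by positivity, fun n => ?_, fun n hn => ?_⟩
    · rcases Nat.eq_zero_or_pos n with rfl | hn
      · simp
      obtain ⟨k, rfl⟩ : ∃ k, n = k + 1 := ⟨n - 1, by omega⟩
      calc ‖∑ m ∈ Finset.range (k + 1), liCoeff (a :: w) m‖
          ≤ ∑ m ∈ Finset.range (k + 1), C * (1 / √(m : ℝ)) := norm_sum_le_of_le _ fun m _ => hterm m
        _ = C * ∑ m ∈ Finset.range (k + 1), 1 / √(m : ℝ) := by rw [Finset.mul_sum]
        _ ≤ C * (2 * √(k : ℝ)) := by gcongr; exact sum_one_div_sqrt_le k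
        _ ≤ C * (2 * √((k + 1 : ℕ) : ℝ)) := by gcongr; omega
        _ = _ := by ring
    · refine (hterm n).trans ?_
      rw [mul_one_div]
      gcongr
      linarith

/-- The leading ξ₀ contributes one more division by n, so the terms are O(n^(-3/2)). -/
theorem summable_liCoeff (w : Word) : Summable (liCoeff (0 :: w)) := by
  obtain ⟨C, hC, -, h⟩ := exists_norm_sum_liCoeff_le w
  have hs := (Real.summable_one_div_nat_rpow.2 (by norm_num : (1 : ℝ) < 3 / 2)).mul_left C
  refine Summable.of_norm_bounded hs fun n => ?_
  rcases Nat.eq_zero_or_pos n with rfl | hn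
  · rw [liCoeff_cons_zero, norm_zero]; positivity
  have hn' : (0 : ℝ) < n := by exact_mod_cast hn
  rw [liCoeff, if_pos rfl, norm_div, Complex.norm_natCast]
  have hpow : (n : ℝ) ^ (3 / 2 : ℝ) = √(n : ℝ) * n := by
    rw [Real.sqrt_eq_rpow, ← Real.rpow_add_one hn'.ne']; norm_num
  rw [hpow]
  calc ‖liCoeff w n‖ / n ≤ C / √(n : ℝ) / n := by gcongr; exact h n hn
    _ = C * (1 / (√(n : ℝ) * n)) := by field_simp

/-- The `n`-th term of the outer sum of a truncated multiple zeta sum. -/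
noncomputable def headTerm : List ℕ → ℕ → ℂ
  | [], _ => 0
  | k :: ks, n => 1 / (n : ℂ) ^ k * truncSum ks n

theorem truncSum_eq {l : List ℕ} (hl : l ≠ []) (N : ℕ) :
    truncSum l N = ∑ n ∈ Finset.Ioo 0 N, headTerm l n := by
  cases l with
  | nil => exact absurd rfl hl
  | cons k ks => rfl

theorem mzv_eq {l : List ℕ} (hl : l ≠ []) : mzv l = ∑' n : ℕ, headTerm l (n + 1) := by
  cases l with
  | nil => exact absurd rfl hl
  | cons k ks => rfl

theorem indexAux_ne_nil (k : ℕ) {w : Word} (hw : IsS0Word w) (h : w ≠ []) :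
    indexAux k w ≠ [] := by
  induction w generalizing k with
  | nil => exact absurd rfl h
  | cons a w ih =>
    rw [indexAux]
    split_ifs with ha
    · subst ha; exact ih _ hw.tail hw.ne_nil
    · simp

theorem truncSum_index_eq {w : Word} (hw : IsS0Word w)
    (h : w ≠ [] → ∀ n, 1 ≤ n → headTerm (index w) n = liCoeff w n) {N : ℕ} (hN : 1 ≤ N) :
    truncSum (index w) N = ∑ m ∈ Finset.range N, liCoeff w m := by
  by_cases hnil : w = []
  · subst hnil
    simp only [index, indexAux, truncSum, liCoeff]
    rw [Finset.sum_ite_eq', if_pos (Finset.mem_range.2 hN)]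
  · rw [index] at h ⊢
    rw [truncSum_eq (indexAux_ne_nil 1 hw hnil), Finset.range_eq_Ico,
      ← Finset.Ioo_insert_left (by omega), Finset.sum_insert (by simp), liCoeff_zero hnil, zero_add]
    exact Finset.sum_congr rfl fun n hn => h hnil n (Finset.mem_Ioo.1 hn).1

/-- The accumulator j counts letters ξ₀ already absorbed into the first exponent, and the factor nʲ
undoes their effect. -/
theorem headTerm_indexAux {w : Word} (hw : IsS0Word w) (hne : w ≠ []) (j : ℕ) {n : ℕ}
    (hn : 1 ≤ n) : headTerm (indexAux (j + 1) w) n * (n : ℂ) ^ j = liCoeff w n := by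
  have hn0 : (n : ℂ) ≠ 0 := by
    have : n ≠ 0 := by omega
    exact_mod_cast this
  induction w generalizing j n with
  | nil => exact absurd rfl hne
  | cons a w ih =>
    rw [indexAux, liCoeff]
    split_ifs with ha
    · subst ha
      rw [← ih hw.tail hw.ne_nil (j + 1) hn hn0, pow_succ]
      field_simp
    · have hsum := truncSum_index_eq hw.tail (fun hne n hn => by
        have h := ih hw.tail hne 0 hn (by
          have : n ≠ 0 := by omega
          exact_mod_cast this)
        rwa [pow_zero, mul_one] at h) hn
      rw [headTerm, ← hsum, index, pow_succ]
      field_simp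

theorem tsum_liCoeff {w : Word} (hw : IsS0Word (0 :: w)) :
    ∑' n, liCoeff (0 :: w) n = mzv (index (0 :: w)) := by
  rw [index, mzv_eq (indexAux_ne_nil 1 hw (by simp)), (summable_liCoeff w).tsum_eq_zero_add,
    liCoeff_cons_zero, zero_add]
  refine tsum_congr fun n => ?_
  have := headTerm_indexAux hw (by simp) 0 (Nat.succ_pos n)
  rw [pow_zero, mul_one] at this
  exact this.symm

/-- Abel's limit theorem: the Taylor series converges at 1, with sum the multiple zeta value. -/
theorem tendsto_iterInt_one {w : Word} (hw : IsS0Word (0 :: w)) :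
    Filter.Tendsto (fun x : ℝ => iterInt (0 :: w) x) (nhdsWithin 1 (Set.Iio 1))
      (nhds (mzv (index (0 :: w)))) := by
  have h := Complex.tendsto_tsum_powerSeries_nhdsWithin_lt
    (summable_liCoeff w).hasSum.tendsto_sum_nat
  rw [tsum_liCoeff hw, Filter.tendsto_map'_iff] at h
  refine h.congr' ?_
  filter_upwards [self_mem_nhdsWithin,
    mem_nhdsWithin_of_mem_nhds (Ioi_mem_nhds (zero_lt_one (α := ℝ)))] with x hx hx0
  refine (hasSum_iterInt hw ?_).tsum_eq
  rw [Complex.norm_real, Real.norm_of_nonneg (le_of_lt hx0)]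
  exact hx

/-! ### The functional equation -/

theorem isS0Word_append_one (v : Word) : IsS0Word (v ++ [1]) := Or.inr ⟨v, rfl⟩

theorem IsS0Word.drop {w : Word} (hw : IsS0Word w) (k : ℕ) : IsS0Word (w.drop k) := by
  induction k generalizing w with
  | zero => exact hw
  | succ k ih =>
    cases w with
    | nil => exact hw
    | cons a w => exact ih hw.tail

theorem liMap_word {w : Word} (hw : IsS0Word w) (z : ℂ) : liMap z (word w) = iterInt w z := by
  rw [liMap_of_mem_S0 z (word_mem_S0 hw), liS_word]

theorem iterInt_one {z : ℂ} (hz : z ∈ D0) : iterInt [1] z = -Complex.log (1 - z) := by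
  have hw : IsS0Word [1] := isS0Word_append_one []
  have hlog : ∀ z ∈ D0, HasDerivAt (fun z => Complex.log (1 - z)) (-1 / (1 - z)) z := fun z hz =>
    ((hasDerivAt_id z).const_sub 1).clog (mem_D0_iff.1 hz)
  rw [← add_eq_zero_iff_eq_neg]
  refine eq_zero_of_hasDerivAt_zero (f := fun z => iterInt [1] z + Complex.log (1 - z)) ?_ ?_ ?_ hz
  · exact (differentiableOn_iterInt hw).add fun z hz =>
      (hlog z hz).differentiableAt.differentiableWithinAt
  · intro x hx hx0
    refine ((hasDerivAt_iterInt hw hx hx0).add (hlog x hx)).congr_deriv ?_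
    rw [formCoeff, if_neg one_ne_zero, iterInt]
    ring
  · simp [iterInt_cons_zero]

theorem isPreconnected_inter : IsPreconnected (D0 ∩ D1) := by
  have hhalf : (((1 / 2 : ℝ) : ℂ)) ∈ D0 ∩ D1 := ofReal_mem_inter (by norm_num) (by norm_num)
  have h1 : StarConvex ℝ ((1 / 2 : ℝ) : ℂ) Complex.slitPlane :=
    Complex.starConvex_ofReal_slitPlane (by norm_num)
  have h : StarConvex ℝ ((1 / 2 : ℝ) : ℂ) (D0 ∩ D1) := by
    intro z hz a b ha hb hab
    refine ⟨mem_D0_iff.2 ?_, mem_D1_iff.2 (h1 (mem_D1_iff.1 hz.2) ha hb hab)⟩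
    have := h1 (mem_D0_iff.1 hz.1) ha hb hab
    convert this using 1
    have hab' : (a : ℂ) + b = 1 := by exact_mod_cast hab
    simp only [Complex.real_smul]
    push_cast
    linear_combination -hab'
  exact (h.isPathConnected hhalf).isConnected.isPreconnected

theorem formCoeff_rev (a : Fin 2) (z : ℂ) : formCoeff a.rev (1 - z) = formCoeff a z := by
  fin_cases a <;> simp [formCoeff, Fin.rev]

theorem hasDerivAt_liMap_cons (a : Fin 2) (x : ShuffleAlg) {z : ℂ} (hz : z ∈ D0 ∩ D1) :
    HasDerivAt (fun z => liMap z (consMap a x)) (formCoeff a z * liMap z x) z := by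
  refine (hasDerivAt_liMap (consMap a x) hz).congr_deriv ?_
  rw [Finset.sum_eq_single a]
  · rw [dL_consMap, if_pos rfl]
  · intro b _ hb; rw [dL_consMap, if_neg hb, map_zero, mul_zero]
  · simp

/-- The left hand side of the functional equation for multiple polylogarithms. -/
noncomputable def liConv (z : ℂ) : Word → ℂ :=
  convWord (fun u => (liMap (1 - z) ∘ₗ tau) (word u)) fun v => liMap z (word v)

theorem hasDerivAt_liMap_one_sub_tau_snoc (a : Fin 2) (u : Word) {z : ℂ} (hz : z ∈ D0 ∩ D1) :
    HasDerivAt (fun z => (liMap (1 - z) ∘ₗ tau) (word (u ++ [a])))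
      (-(formCoeff a z * (liMap (1 - z) ∘ₗ tau) (word u))) z := by
  have htau : tau (word (u ++ [a])) = consMap a.rev (tau (word u)) := by simp
  have h := (hasDerivAt_liMap_cons a.rev (tau (word u)) (one_sub_mem_inter hz)).comp z
    ((hasDerivAt_id z).const_sub 1)
  simp only [LinearMap.comp_apply, htau]
  refine h.congr_deriv ?_
  rw [formCoeff_rev]; ring

theorem liMap_word_nil (z : ℂ) : liMap z (word []) = 1 := by
  rw [liMap_word isS0Word_nil, iterInt]

/-- The telescoping step. Carrying a prefix p makes the induction work: for the first factorization,
the part of the product rule that differentiates the right factor cancels the contribution of the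
longer prefix p ++ [a]. For empty p nothing remains. -/
theorem hasDerivAt_convWord (p w : Word) {D z : ℂ} (hz : z ∈ D0 ∩ D1)
    (hD : HasDerivAt (fun z => (liMap (1 - z) ∘ₗ tau) (word p)) D z) :
    HasDerivAt (fun z => convWord (fun u => (liMap (1 - z) ∘ₗ tau) (word (p ++ u)))
      (fun v => liMap z (word v)) w) (D * liMap z (word w)) z := by
  induction w generalizing p D with
  | nil =>
    simp only [convWord_nil, List.append_nil, liMap_word_nil, mul_one]
    exact hD
  | cons a w ih =>
    simp only [convWord_cons, List.append_nil]
    have h1 := hasDerivAt_liMap_cons a (word w) hz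
    simp only [consMap_word] at h1
    have h2 := ih (p ++ [a]) (hasDerivAt_liMap_one_sub_tau_snoc a p hz)
    simp only [List.append_assoc, List.singleton_append] at h2
    refine ((hD.mul h1).add h2).congr_deriv ?_
    ring

theorem hasDerivAt_liConv (w : Word) {z : ℂ} (hz : z ∈ D0 ∩ D1) :
    HasDerivAt (fun z => liConv z w) 0 z := by
  have h := hasDerivAt_convWord [] w (D := 0) hz (by
    simpa [liMap_word_nil] using hasDerivAt_const z (1 : ℂ))
  rwa [zero_mul] at h

theorem liConv_eq (w : Word) {z z' : ℂ} (hz : z ∈ D0 ∩ D1) (hz' : z' ∈ D0 ∩ D1) :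
    liConv z w = liConv z' w :=
  (isOpen_D0.inter isOpen_D1).is_const_of_deriv_eq_zero isPreconnected_inter
    (fun _ hx => (hasDerivAt_liConv w hx).differentiableAt.differentiableWithinAt)
    (fun _ hx => (hasDerivAt_liConv w hx).deriv) hz hz'

/-- The first factor is O(1 - x), being differentiable and zero at 0; the second is O((1 -
x)^(-1/2)). -/
theorem tendsto_iterInt_mul_iterInt {a : Fin 2} {u v : Word} (hu : IsS0Word (a :: u))
    (hv : IsS0Word v) :
    Filter.Tendsto (fun x : ℝ => iterInt (a :: u) (1 - x) * iterInt v x)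
      (nhdsWithin 1 (Set.Iio 1)) (nhds 0) := by
  obtain ⟨C, hC, hb⟩ := exists_norm_iterInt_ofReal_le hv
  have hdiff := (differentiableOn_iterInt hu).differentiableAt (isOpen_D0.mem_nhds zero_mem_D0)
  obtain ⟨K, hK⟩ := hdiff.isBigO_sub.bound
  simp only [iterInt_cons_zero, sub_zero] at hK
  have hsub : Filter.Tendsto (fun x : ℝ => (1 - x : ℂ)) (nhdsWithin 1 (Set.Iio 1)) (nhds 0) := by
    have : Continuous fun x : ℝ => (1 - x : ℂ) := by fun_prop
    have h := (this.tendsto 1).mono_left (nhdsWithin_le_nhds (s := Set.Iio 1))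
    simpa using h
  have hlim : Filter.Tendsto (fun x : ℝ => K * C * √(1 - x)) (nhdsWithin 1 (Set.Iio 1))
      (nhds 0) := by
    have : Continuous fun x : ℝ => K * C * √(1 - x) := by fun_prop
    have h := (this.tendsto 1).mono_left (nhdsWithin_le_nhds (s := Set.Iio 1))
    simpa using h
  refine squeeze_zero_norm' ?_ hlim
  filter_upwards [hsub.eventually hK, self_mem_nhdsWithin,
    mem_nhdsWithin_of_mem_nhds (Ici_mem_nhds (by norm_num : (1 / 2 : ℝ) < 1))] with x hx hx1 hx0
  have hpos : 0 < 1 - x := sub_pos.2 hx1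
  have hnorm : ‖(1 - x : ℂ)‖ = 1 - x := by
    rw [← Complex.ofReal_one, ← Complex.ofReal_sub, Complex.norm_real, Real.norm_of_nonneg hpos.le]
  rw [hnorm] at hx
  rw [norm_mul]
  calc ‖iterInt (a :: u) (1 - x)‖ * ‖iterInt v x‖ ≤ K * (1 - x) * (C / √(1 - x)) :=
        mul_le_mul hx (hb x hx0 hx1) (norm_nonneg _) ((norm_nonneg _).trans hx)
    _ = K * C * ((1 - x) / √(1 - x)) := by ring
    _ = K * C * √(1 - x) := by rw [Real.div_sqrt]

theorem tendsto_liConv {w : Word} (hw : IsS0Word (0 :: w)) :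
    Filter.Tendsto (fun x : ℝ => liConv x (0 :: w)) (nhdsWithin 1 (Set.Iio 1))
      (nhds (mzv (index (0 :: w)))) := by
  simp only [liConv, convWord, List.length_cons]
  simp only [Finset.sum_range_succ' _ (w.length + 1)]
  rw [← zero_add (mzv _)]
  refine Filter.Tendsto.add ?_ ?_
  · rw [← Finset.sum_const_zero (M := ℂ) (s := Finset.range (w.length + 1))]
    refine tendsto_finsetSum _ fun k _ => ?_
    simp only [List.take_succ_cons, List.drop_succ_cons, LinearMap.comp_apply, tau_word,
      List.map_cons, List.reverse_cons]
    -- The word starts with ξ₀, so every non-empty prefix is sent by `tau` to a word ending in ξ₁,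
    -- whose polylogarithm contains no logarithm of 1 - x.
    have hu : IsS0Word (((w.take k).map Fin.rev).reverse ++ [Fin.rev (0 : Fin 2)]) :=
      isS0Word_append_one _
    have hv : IsS0Word (w.drop k) := hw.tail.drop k
    simp only [liMap_word hu, liMap_word hv]
    obtain ⟨b, u, he⟩ := List.exists_cons_of_ne_nil
      (List.append_ne_nil_of_right_ne_nil ((w.take k).map Fin.rev).reverse
        (List.cons_ne_nil (Fin.rev (0 : Fin 2)) []))
    rw [he] at hu ⊢
    exact tendsto_iterInt_mul_iterInt hu hv
  · simp only [List.take_zero, List.drop_zero, LinearMap.comp_apply, tau_word, List.map_nil,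
      List.reverse_nil, liMap_word_nil, one_mul, liMap_word hw]
    exact tendsto_iterInt_one hw

theorem liConv_cons_zero {w : Word} (hw : IsS0Word (0 :: w)) {z : ℂ} (hz : z ∈ D0 ∩ D1) :
    liConv z (0 :: w) = mzv (index (0 :: w)) := by
  refine tendsto_nhds_unique (tendsto_const_nhds.congr' ?_) (tendsto_liConv hw)
  filter_upwards [self_mem_nhdsWithin,
    mem_nhdsWithin_of_mem_nhds (Ioi_mem_nhds (zero_lt_one (α := ℝ)))] with x hx1 hx0
  exact liConv_eq _ hz (ofReal_mem_inter hx0 hx1)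

theorem zeta_eq (u : ShuffleAlg) : zeta u = ofWords (fun w => mzv (index w)) u := by
  simp [zeta, ofWords, Finsupp.linearCombination_apply]

theorem ofWords_liConv_of_mem_S10 {x : ShuffleAlg} (hx : x ∈ S10) {z : ℂ} (hz : z ∈ D0 ∩ D1) :
    ofWords (liConv z) x = zeta x := by
  rw [zeta_eq]
  refine supported_induction
    (p := fun x => ofWords (liConv z) x = ofWords (fun w => mzv (index w)) x) hx ?_ ?_ ?_ ?_
  · simp
  · intro x y hx hy; rw [map_add, map_add, hx, hy]
  · intro c x hx; rw [map_smul, map_smul, hx]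
  · rintro w (rfl | ⟨v, rfl⟩)
    · rw [ofWords_word, ofWords_word, liConv, convWord_nil, liMap_word_nil]
      simp [liMap_word_nil, index, indexAux, mzv]
    · rw [ofWords_word, ofWords_word]
      exact liConv_cons_zero (isS0Word_append_one (0 :: v)) hz

/-- On either letter the two logarithms in the convolution cancel, so `IsShuffleHom.map_reg10`
reduces to `S10`, where the constant is already known. -/
theorem liConv_eq_zeta (w : Word) {z : ℂ} (hz : z ∈ D0 ∩ D1) :
    liConv z w = zeta (reg10 (word w)) := by
  have hhom : IsShuffleHom (ofWords (liConv z)) :=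
    (isShuffleHom_liMap (one_sub_mem_inter hz).1).comp_tau.conv (isShuffleHom_liMap hz.1)
  have hone : IsS0Word [1] := isS0Word_append_one []
  have hr0 : Fin.rev (0 : Fin 2) = 1 := rfl
  have hr1 : Fin.rev (1 : Fin 2) = 0 := rfl
  have h0 : ofWords (liConv z) (word [0]) = 0 := by
    rw [ofWords_word, liConv, convWord_cons, convWord_nil]
    simp [liMap_word_nil, liMap_word_zero, hr0, liMap_word hone,
      iterInt_one (one_sub_mem_inter hz).1]
  have h1 : ofWords (liConv z) (word [1]) = 0 := by
    rw [ofWords_word, liConv, convWord_cons, convWord_nil]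
    simp [liMap_word_nil, liMap_word_zero, hr1, liMap_word hone, iterInt_one hz.1]
  rw [← ofWords_liConv_of_mem_S10 (reg10_mem_S10 _) hz, hhom.map_reg10 h0 h1, ofWords_word]

/-! ### Holomorphic extensions -/

theorem dense_inter : Dense (D0 ∩ D1) := by
  have h : Dense (Complex.im ⁻¹' {0}ᶜ) := (dense_compl_singleton 0).preimage Complex.isOpenMap_im
  refine h.mono fun z hz => ?_
  have hz' : z.im ≠ 0 := hz
  exact ⟨fun h => hz' h.1, fun h => hz' h.1⟩

/-- Conditions on an arbitrary extension can thus be checked on a single explicit one; density of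
`D0 ∩ D1` and continuity suffice. -/
theorem IsHolExt.eqOn {U : Set ℂ} (hU : D0 ∩ D1 ⊆ U) {f : ↥(D0 ∩ D1) → ℂ} {g h : ℂ → ℂ}
    (hg : IsHolExt U f g) (hh : IsHolExt U f h) : Set.EqOn g h U :=
  Set.EqOn.of_subset_closure (fun z hz => (hg.2 ⟨z, hz⟩).trans (hh.2 ⟨z, hz⟩).symm)
    hg.1.continuousOn hh.1.continuousOn hU (by rw [dense_inter.closure_eq]; exact Set.subset_univ _)

theorem tendsto_deriv_congr {U : Set ℂ} (hU : IsOpen U) {g h : ℂ → ℂ} (heq : Set.EqOn g h U)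
    (ht : Filter.Tendsto (deriv g) (Bornology.cobounded ℂ ⊓ Filter.principal U) (nhds 0)) :
    Filter.Tendsto (deriv h) (Bornology.cobounded ℂ ⊓ Filter.principal U) (nhds 0) := by
  refine ht.congr' ?_
  filter_upwards [Filter.mem_inf_of_right (Filter.mem_principal_self U)] with z hz
  exact (heq.eventuallyEq_of_mem (hU.mem_nhds hz)).deriv_eq

theorem isHolExt_liMap (x : ShuffleAlg) (hx : x ∈ S0) :
    IsHolExt D0 (fun z => liMap z x) fun z => liS z x :=
  ⟨differentiableOn_liS hx, fun z => (liMap_of_mem_S0 (z : ℂ) hx).symm⟩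

theorem isHolExt_liMap_one_sub (x : ShuffleAlg) (hx : x ∈ S0) :
    IsHolExt D1 (fun z => liMap (1 - z) x) fun z => liS (1 - z) x :=
  ⟨(differentiableOn_liS hx).comp (f := fun z : ℂ => 1 - z) (by fun_prop)
    fun _ hz => one_sub_mem_D0.2 hz, fun z => (liMap_of_mem_S0 (1 - z : ℂ) hx).symm⟩

theorem tendsto_deriv_liS_one_sub {x : ShuffleAlg} (hx : x ∈ S0) :
    Filter.Tendsto (deriv fun z => liS (1 - z) x) (Bornology.cobounded ℂ ⊓ Filter.principal D1)
      (nhds 0) := by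
  have h1 : Filter.Tendsto (fun z : ℂ => 1 - z) (Bornology.cobounded ℂ ⊓ Filter.principal D1)
      (Bornology.cobounded ℂ ⊓ Filter.principal D0) := by
    refine Filter.tendsto_inf.2 ⟨Filter.Tendsto.mono_left ?_ inf_le_left, ?_⟩
    · rw [← tendsto_norm_atTop_iff_cobounded]
      refine Filter.tendsto_atTop_mono (fun z => ?_)
        (Filter.tendsto_atTop_add_const_right _ (-1) tendsto_norm_cobounded_atTop)
      have := norm_sub_norm_le z 1
      rw [norm_one, norm_sub_rev] at this
      exact this
    · refine Filter.tendsto_principal.2 ?_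
      filter_upwards [Filter.mem_inf_of_right (Filter.mem_principal_self D1)] with z hz
      exact one_sub_mem_D0.2 hz
  have h2 := ((tendsto_deriv_liS hx).comp h1).neg
  rw [neg_zero] at h2
  refine h2.congr fun z => ?_
  rw [deriv_comp_const_sub (f := fun z => liS z x)]
  rfl

/-- `reg0` preserves length, so no empty word can occur; with `liS_zero` this is the normalization
at 0. -/
theorem reg0_word_nil_apply {w : Word} (hw : w ≠ []) : reg0 (word w) [] = 0 := by
  have h := coeff0_word_mem_homogeneous (Nat.zero_le w.length)
  rw [Nat.sub_zero] at h
  refine mem_homogeneous.1 h [] ?_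
  rw [List.length_nil]
  exact fun h => hw (List.length_eq_zero_iff.1 h.symm)

theorem isRHSolution_liMap :
    IsRHSolution (fun z => liMap z) (fun z => liMap (1 - z)) where
  hom0 z := isShuffleHom_liMap z.2.1
  hom1 z := isShuffleHom_liMap (one_sub_mem_inter z.2).1
  log0 z := liMap_word_zero z
  log1 z := liMap_word_zero _
  hol0 w := ⟨_, isHolExt_liMap _ (reg0_mem_S0 (word w))⟩
  hol1 w := ⟨_, isHolExt_liMap_one_sub _ (reg0_mem_S0 (word w))⟩
  functional_equation w z := by
    have h := liConv_eq_zeta w z.2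
    rw [liConv, convWord] at h
    exact h
  asymptotic0 w _ hg := tendsto_deriv_congr isOpen_D0
    ((isHolExt_liMap _ (reg0_mem_S0 (word w))).eqOn Set.inter_subset_left hg)
    (tendsto_deriv_liS (reg0_mem_S0 (word w)))
  asymptotic1 w _ hg := tendsto_deriv_congr isOpen_D1
    ((isHolExt_liMap_one_sub _ (reg0_mem_S0 (word w))).eqOn Set.inter_subset_right hg)
    (tendsto_deriv_liS_one_sub (reg0_mem_S0 (word w)))
  normalizing w hw g hg := by
    rw [hg.eqOn Set.inter_subset_left (isHolExt_liMap _ (reg0_mem_S0 (word w))) zero_mem_D0]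
    exact (liS_zero _).trans (reg0_word_nil_apply hw)

/-! ### Uniqueness -/

/-- Functions on `D₀` and `D₁` that agree on the intersection and whose derivatives vanish at
infinity are constant. -/
theorem eq_zero_of_eqOn_inter {h₀ h₁ : ℂ → ℂ} (hd₀ : DifferentiableOn ℂ h₀ D0)
    (hd₁ : DifferentiableOn ℂ h₁ D1) (heq : ∀ z ∈ D0 ∩ D1, h₀ z = h₁ z)
    (ht₀ : Filter.Tendsto (deriv h₀) (Bornology.cobounded ℂ ⊓ Filter.principal D0) (nhds 0))
    (ht₁ : Filter.Tendsto (deriv h₁) (Bornology.cobounded ℂ ⊓ Filter.principal D1) (nhds 0))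
    (hzero : h₀ 0 = 0) {z : ℂ} (hz : z ∈ D0) : h₀ z = 0 := by
  classical
  -- Since `D0` and `D1` are open and cover the plane, the glued function is entire.
  set h : ℂ → ℂ := D0.piecewise h₀ h₁ with hh
  have he0 : Set.EqOn h₀ h D0 := fun z hz => (D0.piecewise_eq_of_mem _ _ hz).symm
  have he1 : Set.EqOn h₁ h D1 := fun z hz => by
    by_cases hz0 : z ∈ D0
    · rw [← he0 hz0]; exact (heq z ⟨hz0, hz⟩).symm
    · exact (D0.piecewise_eq_of_notMem _ _ hz0).symm
  have hunion : ∀ z : ℂ, z ∈ D0 ∨ z ∈ D1 := by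
    intro z
    by_contra! hcon
    obtain ⟨h0, h1⟩ := hcon
    simp only [D0, D1, Set.mem_ofPred_eq, not_not] at h0 h1
    linarith [h0.2, h1.2]
  have hdiff : Differentiable ℂ h := by
    intro z
    rcases hunion z with hz | hz
    · exact (hd₀.differentiableAt (isOpen_D0.mem_nhds hz)).congr_of_eventuallyEq
        (he0.symm.eventuallyEq_of_mem (isOpen_D0.mem_nhds hz))
    · exact (hd₁.differentiableAt (isOpen_D1.mem_nhds hz)).congr_of_eventuallyEq
        (he1.symm.eventuallyEq_of_mem (isOpen_D1.mem_nhds hz))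
  have htend : Filter.Tendsto (deriv h) (Filter.cocompact ℂ) (nhds 0) := by
    rw [← Metric.cobounded_eq_cocompact]
    have hsup := (tendsto_deriv_congr isOpen_D0 he0 ht₀).sup (tendsto_deriv_congr isOpen_D1 he1 ht₁)
    have huniv : D0 ∪ D1 = Set.univ := Set.eq_univ_of_forall hunion
    rwa [← inf_sup_left, Filter.sup_principal, huniv, Filter.principal_univ, inf_top_eq] at hsup
  -- Liouville, applied to the entire derivative rather than to the function.
  have hderiv : ∀ z, deriv h z = 0 := fun z =>
    hdiff.deriv.apply_eq_of_tendsto_cocompact z htend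
  rw [he0 hz, is_const_of_deriv_eq_zero hdiff hderiv z 0, ← he0 zero_mem_D0, hzero]

theorem eq_on_homogeneous {φ ψ : ShuffleAlg →ₗ[ℂ] ℂ} {m : ℕ}
    (h : ∀ w : Word, w.length = m → φ (word w) = ψ (word w)) {x : ShuffleAlg}
    (hx : x ∈ homogeneous m) : φ x = ψ x := by
  refine supported_induction (p := fun x => φ x = ψ x) hx ?_ ?_ ?_ h
  · simp
  · intro x y hx hy; rw [map_add, map_add, hx, hy]
  · intro c x hx; rw [map_smul, map_smul, hx]

/-- All terms of positive degree in ξ₀ have coefficients supported on shorter words, by homogeneity.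
There φ and ψ agree, as they do on ξ₀, so only the constant term can contribute to the difference.
-/
theorem IsShuffleHom.sub_reg0 {φ ψ : ShuffleAlg →ₗ[ℂ] ℂ} (hφ : IsShuffleHom φ)
    (hψ : IsShuffleHom ψ) (h0 : φ (word [0]) = ψ (word [0])) {w : Word}
    (h : ∀ v : Word, v.length < w.length → φ (word v) = ψ (word v)) :
    φ (word w) - ψ (word w) = φ (reg0 (word w)) - ψ (reg0 (word w)) := by
  have key : ∀ χ : ShuffleAlg →ₗ[ℂ] ℂ, IsShuffleHom χ → χ (word w) = χ (reg0 (word w)) +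
      ∑ j ∈ Finset.range w.length,
        χ (coeff0 (word w) (j + 1)) * (χ (word [0]) ^ (j + 1) / ((j + 1).factorial : ℂ)) := by
    intro χ hχ
    conv_lhs => rw [(isPoly0_coeff0 (word w)).2]
    rw [Finsupp.sum_of_support_subset (s := Finset.range (w.length + 1)), map_sum,
      Finset.sum_range_succ', add_comm]
    · simp [hχ.map_shuffle, hχ.map_replicate, reg0]
    · intro j hj
      by_contra hlt
      rw [Finset.mem_range, not_lt] at hlt
      exact Finsupp.mem_support_iff.1 hj (coeff0_word_eq_zero hlt)
    · simp
  rw [key φ hφ, key ψ hψ, h0]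
  have : ∀ j ∈ Finset.range w.length,
      φ (coeff0 (word w) (j + 1)) = ψ (coeff0 (word w) (j + 1)) := fun j hj => by
    have hj' := Finset.mem_range.1 hj
    exact eq_on_homogeneous (m := w.length - (j + 1)) (fun v hv => h v (by omega))
      (coeff0_word_mem_homogeneous hj')
  rw [Finset.sum_congr rfl fun j hj => by rw [this j hj]]
  ring

/-- The second family is tested on `tau (word w)` because that is how it enters the functional
equation; both statements must be carried through the induction together. -/
theorem IsRHSolution.eq_on_word {f0 f1 g0 g1 : ↥(D0 ∩ D1) → (ShuffleAlg →ₗ[ℂ] ℂ)}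
    (hf : IsRHSolution f0 f1) (hg : IsRHSolution g0 g1) (n : ℕ) (w : Word) (hn : w.length = n)
    (z : ↥(D0 ∩ D1)) :
    f0 z (word w) = g0 z (word w) ∧ f1 z (tau (word w)) = g1 z (tau (word w)) := by
  induction n using Nat.strong_induction_on generalizing w z with
  | _ n ih =>
    rcases Nat.eq_zero_or_pos n with rfl | hpos
    · obtain rfl := List.length_eq_zero_iff.1 hn
      simp [(hf.hom0 z).map_one, (hf.hom1 z).map_one, (hg.hom0 z).map_one, (hg.hom1 z).map_one]
    set w' : Word := (w.map Fin.rev).reverse with hw'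
    have htau : tau (word w) = word w' := tau_word w
    have hlen : w'.length = n := by simp [hw', hn]
    -- Split off the first and last factorizations; in all others both factors are shorter than w,
    -- so the induction hypothesis applies.
    have hsum : ∀ z, f0 z (word w) + f1 z (tau (word w)) =
        g0 z (word w) + g1 z (tau (word w)) := by
      intro z
      have h := (hf.functional_equation w z).trans (hg.functional_equation w z).symm
      obtain ⟨m, hm⟩ : ∃ m, w.length = m + 1 := ⟨n - 1, by omega⟩
      rw [hm, Finset.sum_range_succ, Finset.sum_range_succ', Finset.sum_range_succ,
        Finset.sum_range_succ' _ m] at h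
      have hmid : ∑ k ∈ Finset.range m,
          f1 z (tau (word (w.take (k + 1)))) * f0 z (word (w.drop (k + 1))) =
          ∑ k ∈ Finset.range m,
          g1 z (tau (word (w.take (k + 1)))) * g0 z (word (w.drop (k + 1))) := by
        refine Finset.sum_congr rfl fun k hk => ?_
        have hk' := Finset.mem_range.1 hk
        rw [(ih (k + 1) (by omega) (w.take (k + 1)) (by rw [List.length_take]; omega) z).2,
          (ih (w.length - (k + 1)) (by omega) (w.drop (k + 1)) (by rw [List.length_drop]) z).1]
      rw [hmid, ← hm, List.take_length, List.drop_length, List.take_zero, List.drop_zero, tau_word,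
        List.map_nil, List.reverse_nil, (hf.hom0 z).map_one, (hf.hom1 z).map_one,
        (hg.hom0 z).map_one, (hg.hom1 z).map_one] at h
      linear_combination h
    have hred0 : ∀ z, f0 z (word w) - g0 z (word w) =
        f0 z (reg0 (word w)) - g0 z (reg0 (word w)) := fun z =>
      (hf.hom0 z).sub_reg0 (hg.hom0 z) ((hf.log0 z).trans (hg.log0 z).symm)
        fun v hv => (ih v.length (by omega) v rfl z).1
    have hred1 : ∀ z, f1 z (word w') - g1 z (word w') =
        f1 z (reg0 (word w')) - g1 z (reg0 (word w')) := fun z =>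
      (hf.hom1 z).sub_reg0 (hg.hom1 z) ((hf.log1 z).trans (hg.log1 z).symm) fun v hv => by
        have h := (ih v.length (by omega) (v.map Fin.rev).reverse (by simp) z).2
        rwa [← tau_word, tau_tau] at h
    obtain ⟨F0, hF0⟩ := hf.hol0 w
    obtain ⟨F1, hF1⟩ := hf.hol1 w'
    obtain ⟨G0, hG0⟩ := hg.hol0 w
    obtain ⟨G1, hG1⟩ := hg.hol1 w'
    have hwne : w ≠ [] := by rintro rfl; simp at hn; omega
    have htend : ∀ {U : Set ℂ} {F G : ℂ → ℂ}, IsOpen U → DifferentiableOn ℂ F U →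
        DifferentiableOn ℂ G U →
        Filter.Tendsto (deriv F) (Bornology.cobounded ℂ ⊓ Filter.principal U) (nhds 0) →
        Filter.Tendsto (deriv G) (Bornology.cobounded ℂ ⊓ Filter.principal U) (nhds 0) →
        Filter.Tendsto (deriv (F - G)) (Bornology.cobounded ℂ ⊓ Filter.principal U) (nhds 0) := by
      intro U F G hU hdF hdG hF hG
      have h := hF.sub hG
      rw [sub_zero] at h
      refine h.congr' ?_
      filter_upwards [Filter.mem_inf_of_right (Filter.mem_principal_self U)] with z hz
      exact (deriv_sub (hdF.differentiableAt (hU.mem_nhds hz))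
        (hdG.differentiableAt (hU.mem_nhds hz))).symm
    -- The order is reversed on `D1`: the identity `hsum` turns f0 - g0 into g1 - f1.
    have hvanish : (F0 - G0) z = 0 :=
      eq_zero_of_eqOn_inter (h₁ := G1 - F1) (hF0.1.sub hG0.1) (hG1.1.sub hF1.1)
        (fun y hy => by
          have e0 := hred0 ⟨y, hy⟩
          have e1 := hred1 ⟨y, hy⟩
          have e := hsum ⟨y, hy⟩
          rw [htau] at e
          have a0 := hF0.2 ⟨y, hy⟩
          have a1 := hF1.2 ⟨y, hy⟩
          have b0 := hG0.2 ⟨y, hy⟩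
          have b1 := hG1.2 ⟨y, hy⟩
          simp only at a0 a1 b0 b1
          rw [Pi.sub_apply, Pi.sub_apply, a0, a1, b0, b1]
          linear_combination e - e0 - e1)
        (htend isOpen_D0 hF0.1 hG0.1 (hf.asymptotic0 w _ hF0) (hg.asymptotic0 w _ hG0))
        (htend isOpen_D1 hG1.1 hF1.1 (hg.asymptotic1 w' _ hG1) (hf.asymptotic1 w' _ hF1))
        (by rw [Pi.sub_apply, hf.normalizing w hwne _ hF0, hg.normalizing w hwne _ hG0, sub_zero])
        z.2.1
    have h0 : f0 z (word w) = g0 z (word w) := by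
      rw [Pi.sub_apply, hF0.2 z, hG0.2 z, ← hred0 z] at hvanish
      exact sub_eq_zero.1 hvanish
    exact ⟨h0, by have := hsum z; rw [h0] at this; exact add_left_cancel this⟩

theorem IsRHSolution.unique {f0 f1 g0 g1 : ↥(D0 ∩ D1) → (ShuffleAlg →ₗ[ℂ] ℂ)}
    (hf : IsRHSolution f0 f1) (hg : IsRHSolution g0 g1) : f0 = g0 ∧ f1 = g1 := by
  refine ⟨funext fun z => linearMap_ext_word fun w => (hf.eq_on_word hg _ w rfl z).1,
    funext fun z => linearMap_ext_word fun w => ?_⟩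
  have h := (hf.eq_on_word hg _ (w.map Fin.rev).reverse rfl z).2
  rwa [← tau_word, tau_tau] at h

end MPL

open MPL
theorem mainTheorem1
    (duality : ∀ w : Word, zeta (reg10 (word w)) = zeta (reg10 (tau (word w)))) :
    ∃ f0 f1 : ↥(D0 ∩ D1) → (ShuffleAlg →ₗ[ℂ] ℂ),
      IsRHSolution f0 f1 ∧
      (∀ g0 g1 : ↥(D0 ∩ D1) → (ShuffleAlg →ₗ[ℂ] ℂ), IsRHSolution g0 g1 → g0 = f0 ∧ g1 = f1) ∧
      (∀ (w : ShuffleAlg) (z : ↥(D0 ∩ D1)), f0 z w = Li w z ∧ f1 z w = Li w (1 - z)) ∧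
      (∀ w : Word,
        IsHolExt D0 (fun z => f0 z (reg0 (word w))) (Li (reg0 (word w))) ∧
        IsHolExt D1 (fun z => f1 z (reg0 (word w))) (fun z => Li (reg0 (word w)) (1 - z))) := by
  have hLi : ∀ w : Word, Li (reg0 (word w)) = fun z => liS z (reg0 (word w)) := fun w =>
    funext fun z => liMap_of_mem_S0 z (reg0_mem_S0 (word w))
  refine ⟨fun z => liMap z, fun z => liMap (1 - z), isRHSolution_liMap,
    fun g0 g1 hg => hg.unique isRHSolution_liMap, fun w z => ⟨rfl, rfl⟩, fun w => ?_⟩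
  rw [hLi]
  exact ⟨isHolExt_liMap _ (reg0_mem_S0 (word w)), isHolExt_liMap_one_sub _ (reg0_mem_S0 (word w))⟩
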